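/- **Theories.** A clause $H\leftarrow B$ consists of finite sets $H$ (head) and $B$ (body) of atoms; it is *disjunctive* if $|H|>1$. A theory $\Pi$ is a finite set of clauses, and it is *positive* if all heads are non-empty. A set $I$ of atoms of $\Pi$ is a *model* if for every clause $H\leftarrow B$ of $\Pi$, $H\cap I\ne\emptyset$ or $B\not\subseteq I$; it is *minimal* if no proper subset of it is a model. Write $\mathrm{atom}(\Pi)$ for the set of atoms of $\Pi$, $\Pi^{nd}$ for the set of its non-disjunctive clauses, and $\Pi_X$ (resp. $\Pi_{X\leftarrow}$) for the set of all clauses $H\cap X\leftarrow B\cap X$ (resp. $H\cap X\leftarrow B$) with $H\leftarrow B$ in $\Pi$ and $H\cap X\neq\emptyset$. A set $Z\subseteq Y$ is *outbound* in $Y$ for $\Pi$ if some clause $H\leftarrow B$ of $\Pi$ satisfies $H\cap Z\ne\emptyset$, $B\cap(Y\setminus Z)\neq\emptyset$, $B\cap Z=\emptyset$ and $H\cap (Y\setminus Z)=\emptyset$. A non-empty $Y\subseteq\mathrm{atom}(\Pi)$ is *elementary* if all its non-empty proper subsets are outbound in $Y$. $\Pi$ is *head-elementary-set-free (HEF)*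 if $|E\cap H|\le 1$ for every clause $H\leftarrow B$ of $\Pi$ and every elementary set $E$ for $\Pi$. **Algorithms.** For a set $M$ of atoms let $S_M$ be the minimal model of $(\Pi_{M\leftarrow})^{nd}$, computed by unit propagation, and let $Q_M=\{H\leftarrow B\in\Pi: H\cap S_M=\emptyset,\ B\subseteq M\}_{M\setminus S_M}$. *Elementary subgraph* of a set of atoms $X$ for a non-disjunctive theory $N$: the directed graph on $X$ obtained, starting without arcs, by repeatedly taking out of $N_X$ all clauses $h\leftarrow B$ whose body lies in one strongly connected component of the current graph and adding the arcs $(b,h)$, $b\in B$, until there are no such clauses. *find(Q)*: start with $X=\mathrm{atom}(Q)$; while the elementary subgraph of $X$ for $Q^{nd}$ is not strongly connected, select one of its strongly connected components without arcs to other components and remove it from $X$; return $X$. $\xi_{\mathrm{HEF}}(\Pi,M)$: set $E'=\emptyset$. Repeat: put $M:=M\setminus E'$; if $M\setminus S_M\supsetneq\mathrm{atom}(Q_M)$ let $\Delta=(M\setminus S_M)\setminus\mathrm{atom}(Q_M)$; else if $M\setminus S_M\supsetneq\mathrm{atom}(Q_M^{nd})$ let $\Delta=\{a\}$ for a selected $a\in(M\setminus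 S_M)\setminus\mathrm{atom}(Q_M^{nd})$; else let $\Delta=\emptyset$; put $E':=E'\cup\Delta$; until $\Delta=\emptyset$. If $Q_M$ is non-disjunctive return $E'\cup(M\setminus S_M)$, otherwise return $E'\cup \mathrm{find}(Q_M)$. $\mathrm{IGEA}(\xi_{\mathrm{HEF}})$ on $\Pi$: let $M$ be the set of all head atoms of $\Pi$. Repeat: if $S_M$ is a model of $\Pi$, return $S_M$ and "success". Otherwise let $E=\xi_{\mathrm{HEF}}(\Pi,M)$. If $E=\emptyset$, return $M$ and "success". If $M\setminus E$ is not a model of $\Pi$, return $M$ and "failure". Otherwise put $M:=M\setminus E$. **Theorem.** There is a polynomial $p$ such that for every positive CNF theory $\Pi$, and however the selections in the algorithm are made, $\mathrm{IGEA}(\xi_{\mathrm{HEF}})$ terminates on $\Pi$ after at most $p(|\Pi|)$ elementary steps, where $|\Pi|$ is the number of clauses plus the number of occurrences of atoms, and sets are handled as lists, with one step paid for each comparison of two atoms, each list cell visited and each loop iteration. Moreover, if $\Pi$ is HEF, the algorithm declares success and returns a minimal model of $\Pi$; otherwise, it either declares success and returns a minimal model of $\Pi$, or declares failure and returns a model of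 $\Pi$. -/

import Mathlib

namespace CNF

/-! ## Clausal theories and their models -/

/-- A clause (rule) `H ← B`; the lists `head` and `body` present the finite sets of atoms `H` and `B`
(order and repetitions carry no meaning). -/
structure Clause (α : Type) where
  head : List α
  body : List α

/-- The set of head atoms. -/
def Clause.H {α : Type} (c : Clause α) : Set α := {a | a ∈ c.head}

/-- The set of body atoms. -/
def Clause.B {α : Type} (c : Clause α) : Set α := {a | a ∈ c.body}

/-- A CNF theory: a finite set of clauses, presented by a list. -/
abbrev Theory (α : Type) := List (Clause α)

/-- The size of a theory: the number of its clauses plus the number of occurrences of atoms. -/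
def Theory.size {α : Type} (T : Theory α) : ℕ :=
  (T.map fun c => 1 + c.head.length + c.body.length).sum

/-- The set of atoms occurring in a theory. -/
def Theory.atoms {α : Type} (T : Theory α) : Set α := {a | ∃ c ∈ T, a ∈ c.H ∨ a ∈ c.B}

/-- A theory is positive if it has no constraint, i.e. no clause with empty head. -/
def Theory.Positive {α : Type} (T : Theory α) : Prop := ∀ c ∈ T, c.H.Nonempty

/-- A clause is true in `I` if some head atom is true or some body atom is false in `I`. -/
def Clause.Holds {α : Type} (c : Clause α) (I : Set α) : Prop :=
  (∃ a ∈ c.H, a ∈ I) ∨ (∃ a ∈ c.B, a ∉ I)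

/-- Models are sets of atoms of the theory in which all its clauses are true. -/
def Theory.IsModel {α : Type} (T : Theory α) (I : Set α) : Prop :=
  I ⊆ T.atoms ∧ ∀ c ∈ T, c.Holds I

def Theory.IsMinimalModel {α : Type} (T : Theory α) (I : Set α) : Prop :=
  T.IsModel I ∧ ∀ J, J ⊂ I → ¬ T.IsModel J

/-! ## Head-elementary-set-free theories -/

/-- `Z` is outbound in `Y` for `T`. -/
def Theory.Outbound {α : Type} (T : Theory α) (Y Z : Set α) : Prop :=
  Z ⊆ Y ∧ ∃ c ∈ T, (c.H ∩ Z).Nonempty ∧ (c.B ∩ (Y \ Z)).Nonempty ∧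
    c.B ∩ Z = ∅ ∧ c.H ∩ (Y \ Z) = ∅

/-- A non-empty set of atoms of `T` is elementary if all its non-empty proper subsets are outbound
in it. -/
def Theory.Elementary {α : Type} (T : Theory α) (Y : Set α) : Prop :=
  Y.Nonempty ∧ Y ⊆ T.atoms ∧ ∀ Z, Z ⊂ Y → Z.Nonempty → T.Outbound Y Z

/-- `T` is head-elementary-set-free. -/
def Theory.IsHEF {α : Type} (T : Theory α) : Prop :=
  ∀ c ∈ T, ¬ ∃ E, T.Elementary E ∧ 1 < (E ∩ c.H).encard

/-! ## The cost model

A computation is run on a budget of elementary steps.  It returns its value and the unspent part of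
the budget, or `none` when the budget runs out (in particular, if it diverges).  The programs below
use the budget only through `tick`.  One `tick` is paid for every comparison of two atoms, for every
cell visited by a list traversal, and for every iteration of a `repeat` loop; the work done between
two consecutive ticks (constructing a cell or a tuple, inspecting a constructor, a Boolean operation)
is bounded by a constant. -/

abbrev Comp := StateT ℕ Option

/-- Pay for one elementary step. -/
def tick : Comp Unit := fun b =>
  match b with
  | 0 => none
  | b + 1 => some ((), b)

/-- `c` halts after at most `t` steps, returning `v`. -/
def HaltsWithin {β : Type} (c : Comp β) (t : ℕ) (v : β) : Prop :=
  ∃ rest, c t = some (v, rest)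

/-- At most `k` iterations of a loop body; `none` if the loop is not left by then. -/
def loopAux {σ β : Type} (f : σ → Comp (σ ⊕ β)) : ℕ → σ → Comp β
  | 0, _ => fun _ => none
  | k + 1, s => do
    tick
    match ← f s with
    | .inl s' => loopAux f k s'
    | .inr v => pure v

/-- Unbounded iteration: `inl` continues with a new state, `inr` leaves the loop.  As each iteration
costs at least one step, a budget of `b` steps never allows for more than `b` iterations. -/
def loop {σ β : Type} (f : σ → Comp (σ ⊕ β)) (s : σ) : Comp β :=
  fun b => loopAux f b s b

/-! ## List traversals -/

def anyC {β : Type} (p : β → Comp Bool) : List β → Comp Bool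
  | [] => do tick; pure false
  | x :: l => do
    tick
    if ← p x then pure true else anyC p l

def allC {β : Type} (p : β → Comp Bool) : List β → Comp Bool
  | [] => do tick; pure true
  | x :: l => do
    tick
    if ← p x then allC p l else pure false

/-- The elements that satisfy `p`, and those that do not. -/
def splitC {β : Type} (p : β → Comp Bool) : List β → Comp (List β × List β)
  | [] => do tick; pure ([], [])
  | x :: l => do
    tick
    let r ← splitC p l
    if ← p x then pure (x :: r.1, r.2) else pure (r.1, x :: r.2)

def filterC {β : Type} (p : β → Comp Bool) (l : List β) : Comp (List β) := do
  let r ← splitC p l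
  pure r.1

def mapC {β γ : Type} (f : β → Comp γ) : List β → Comp (List γ)
  | [] => do tick; pure []
  | x :: l => do
    tick
    let y ← f x
    let r ← mapC f l
    pure (y :: r)

def foldC {β γ : Type} (f : γ → β → Comp γ) : γ → List β → Comp γ
  | z, [] => do tick; pure z
  | z, x :: l => do
    tick
    let z' ← f z x
    foldC f z' l

/-- The entry with index `n` of the list `x :: l`, or its last entry if there is none. -/
def pick {β : Type} : β → List β → ℕ → Comp β
  | x, [], _ => do tick; pure x
  | x, _ :: _, 0 => do tick; pure x
  | _, y :: l, n + 1 => do tick; pick y l n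

/-! ## Finite sets of atoms as lists -/

section Sets

variable {α : Type} [DecidableEq α]

def eqC (a b : α) : Comp Bool := do tick; pure (decide (a = b))

def memC (a : α) (X : List α) : Comp Bool := anyC (fun b => eqC a b) X

def subsetC (X Y : List α) : Comp Bool := allC (fun a => memC a Y) X

/-- Is `X` a proper superset of `Y`? -/
def ssupsetC (X Y : List α) : Comp Bool := do
  let p ← subsetC Y X
  let q ← subsetC X Y
  pure (p && !q)

/-- Do `X` and `Y` intersect? -/
def meetsC (X Y : List α) : Comp Bool := anyC (fun a => memC a Y) X

def interC (X Y : List α) : Comp (List α) := filterC (fun a => memC a Y) X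

def diffC (X Y : List α) : Comp (List α) := do
  let r ← splitC (fun a => memC a Y) X
  pure r.2

def insertC (X : List α) (a : α) : Comp (List α) := do
  if ← memC a X then pure X else pure (a :: X)

def unionC (X Y : List α) : Comp (List α) := foldC insertC X Y

/-! ## Operations on theories -/

/-- All head atoms of `T`. -/
def headsC (T : Theory α) : Comp (List α) := foldC (fun X c => unionC X c.head) [] T

/-- All atoms of `T`. -/
def atomsC (T : Theory α) : Comp (List α) :=
  foldC (fun X c => do unionC (← unionC X c.head) c.body) [] T

/-- Is the clause true in `I`? -/
def holdsC (c : Clause α) (I : List α) : Comp Bool := do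
  if ← subsetC c.body I then meetsC c.head I else pure true

def isModelC (T : Theory α) (I : List α) : Comp Bool := allC (fun c => holdsC c I) T

/-- Does the head consist of at most one atom? -/
def isHornC (c : Clause α) : Comp Bool :=
  match c.head with
  | [] => do tick; pure true
  | h :: l => allC (fun a => eqC h a) l

/-- `T^nd`, the non-disjunctive clauses of `T`. -/
def ndC (T : Theory α) : Comp (Theory α) := filterC isHornC T

def hasHeadC (c : Clause α) : Comp Bool := do tick; pure (!c.head.isEmpty)

/-- `T_{X←}`: intersect all heads with `X`; keep the clauses with non-empty head. -/
def projHeadC (T : Theory α) (X : List α) : Comp (Theory α) := do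
  let T' ← mapC (fun c => do pure (Clause.mk (← interC c.head X) c.body)) T
  filterC hasHeadC T'

/-- `T_X`: intersect all heads and bodies with `X`; keep the clauses with non-empty head. -/
def projC (T : Theory α) (X : List α) : Comp (Theory α) := do
  let T' ← mapC (fun c => do pure (Clause.mk (← interC c.head X) (← interC c.body X))) T
  filterC hasHeadC T'

/-- The minimal model of a positive non-disjunctive theory, by unit propagation: starting from the
empty set, add the heads of all clauses that are false, until there are none. -/
def leastModelC (T : Theory α) : Comp (List α) :=
  loop (fun S => do
    let F ← filterC (fun c => do pure (!(← holdsC c S))) T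
    if F.isEmpty then pure (.inr S)
    else pure (.inl (← unionC S (← headsC F)))) []

/-- The steady set of `M` for `T`: the minimal model of `(T_{M←})^nd`. -/
def steadyC (T : Theory α) (M : List α) : Comp (List α) := do
  leastModelC (← ndC (← projHeadC T M))

/-- The simplified theory of `T` with respect to `M`, whose steady set is `S`: the clauses with
`H ∩ S = ∅` and `B ⊆ M`, projected on `M \ S`. -/
def simplifiedC (T : Theory α) (M S : List α) : Comp (Theory α) := do
  let T' ← filterC (fun c => do
    if ← meetsC c.head S then pure false else subsetC c.body M) T
  projC T' (← diffC M S)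

/-! ## Elementary subgraphs

A directed graph is given by the list of its arcs. -/

/-- The nodes that can be reached from `a` (including `a`). -/
def reachC (E : List (α × α)) (a : α) : Comp (List α) :=
  loop (fun R => do
    let F ← filterC (fun e => do
      if ← memC e.1 R then pure (!(← memC e.2 R)) else pure false) E
    if F.isEmpty then pure (.inr R)
    else pure (.inl (← foldC (fun Q e => insertC Q e.2) R F))) [a]

/-- Do all nodes in `X` lie in one strongly connected component?  If `X` consists of all the nodes,
this says that the graph is strongly connected. -/
def connectedC (E : List (α × α)) (X : List α) : Comp Bool :=
  allC (fun a => do subsetC X (← reachC E a)) X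

/-- The arcs of the elementary subgraph of `X` for the non-disjunctive theory `T`: starting without
arcs, repeatedly take out of `T_X` the clauses `h ← B` whose body lies in one strongly connected
component and add their arcs `(b, h)`, `b ∈ B`, until there are no such clauses. -/
def elementarySubgraphC (T : Theory α) (X : List α) : Comp (List (α × α)) := do
  let TX ← projC T X
  loop (fun s : Theory α × List (α × α) => do
    let C ← splitC (fun c => connectedC s.2 c.body) s.1
    if C.1.isEmpty then pure (.inr s.2)
    else
      let E ← foldC (fun E c =>
        foldC (fun E h => foldC (fun E b => pure ((b, h) :: E)) E c.body) E c.head) s.2 C.1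
      pure (.inl (C.2, E))) (TX, [])

/-- The strongly connected component of the node `a`. -/
def componentC (E : List (α × α)) (X : List α) (a : α) : Comp (List α) := do
  let R ← reachC E a
  filterC (fun b => do if ← memC b R then memC a (← reachC E b) else pure false) X

/-- The strongly connected components without arcs to other components, i.e. those of the last
level (a component is listed once for each of its nodes). -/
def lastLevelC (E : List (α × α)) (X : List α) : Comp (List (List α)) := do
  let Y ← filterC (fun a => do subsetC (← reachC E a) (← componentC E X a)) X
  mapC (componentC E X) Y

end Sets

/-! ## The algorithm -/

/-- How the two `select` instructions of the algorithm are resolved: given the situation at hand and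
the list of all candidates, the position of the candidate to be taken. -/
structure Selection (α : Type) where
  /-- for a theory, the current model, and the candidate atoms -/
  atom : Theory α → List α → List α → ℕ
  /-- for a theory, the current set of atoms, and the candidate components -/
  component : Theory α → List α → List (List α) → ℕ

section Algorithm

variable {α : Type} [DecidableEq α]

/-- The function `find_super-elementary_set`. -/
def findSuperElementarySet (sel : Selection α) (T : Theory α) : Comp (List α) := do
  let X₀ ← atomsC T
  let N ← ndC T
  loop (fun X => do
    let E ← elementarySubgraphC N X
    if ← connectedC E X then pure (.inr X)
    else
      let L ← lastLevelC E X
      match L with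
      | [] => pure (.inr X)
      | C₀ :: L' =>
        let C ← pick C₀ L' (sel.component T X L)
        pure (.inl (← diffC X C))) X₀

/-- The set `ΔE` computed in one iteration of the loop of `ξ_HEF`, for the current model `M`, its
steady set `S` and the simplified theory `Q`. -/
def deltaC (sel : Selection α) (T : Theory α) (M S : List α) (Q : Theory α) : Comp (List α) := do
  let R ← diffC M S
  let A ← atomsC Q
  let A' ← atomsC (← ndC Q)
  if ← ssupsetC R A then diffC R A
  else if ← ssupsetC R A' then
    let D ← diffC R A'
    match D with
    | [] => pure []
    | a :: D' =>
      let x ← pick a D' (sel.atom T M D)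
      pure [x]
  else pure []

/-- The operator `ξ_HEF`.  The loop state is `(M, E')`; the loop is left with `(M, S, Q, E')`, where
`S` is the steady set of `M` and `Q` the simplified theory. -/
def xiHEF (sel : Selection α) (T : Theory α) (M₀ : List α) : Comp (List α) := do
  let r ← loop (fun s : List α × List α => do
    let M ← diffC s.1 s.2
    let S ← steadyC T M
    let Q ← simplifiedC T M S
    let Δ ← deltaC sel T M S Q
    let E ← unionC s.2 Δ
    if Δ.isEmpty then pure (.inr (M, S, Q, E)) else pure (.inl (M, E))) (M₀, [])
  let (M, S, Q, E') := r
  let E'' ← (do if ← allC isHornC Q then diffC M S else findSuperElementarySet sel Q)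
  unionC E' E''

inductive Verdict
  | success
  | failure

/-- The incomplete generalized elimination algorithm with operator `ξ`. -/
def igea (ξ : Theory α → List α → Comp (List α)) (T : Theory α) : Comp (Verdict × List α) := do
  let M₀ ← headsC T
  loop (fun M => do
    let S ← steadyC T M
    if ← isModelC T S then pure (.inr (Verdict.success, S))
    else
      let E ← ξ T M
      if E.isEmpty then pure (.inr (Verdict.success, M))
      else
        let M' ← diffC M E
        if ← isModelC T M' then pure (.inl M')
        else pure (.inr (Verdict.failure, M))) M₀

end Algorithm

end CNF

/-! The main loop keeps a set `M` in which all clauses hold and shrinks it. The steady set of `M`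
lies in every model contained in `M`; hence it is a minimal model as soon as it is a model, and `M`
itself is minimal once it equals its steady set. What remains concerns the set `E` proposed by the
operator: `E = ∅` must force `M` into its steady set, and for an HEF theory `M \ E` must again be a
model (`runs_xiHEF`).

By `IsSimplified.holds_diff`, a set `D` disjoint from the steady set can be removed if every clause
of the simplified theory `Q` whose body misses `D` keeps a head atom outside `D`. This covers each
`Δ` and, as Horn clauses of `Q` have non-empty bodies, the whole of `M \ S` when `Q` is Horn.
Otherwise a non-empty `X` is found that is elementary for the Horn part of `Q`, hence for the
original theory (`IsSuperElementary.elementary`), and that meets the body of each Horn clause whose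
head it meets. Under HEF a clause of `Q` with its head inside `X` must be Horn, so its body meets
`X`, and `X` can be removed.

Elementarity of `X` comes from strong connectivity of its elementary subgraph: a set that is not
outbound is closed under predecessors. The body condition survives the deletion of a component
without outgoing arcs: a clause whose body atoms in `X` all lie in that component has its head there
as well (`runs_findSuperElementarySet`).

For the cost, `Runs` couples a postcondition with a step bound. Atom lists are duplicate-free over
one universe of at most `n` entries, graphs have at most `n ^ 3` arcs, and every loop has a measure
bounded by `n`, so all bounds are nested `iter` expressions, polynomial in `n`. -/

namespace CNF

/-! ## Total correctness with a bound on the cost -/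

/-- Within `t` steps, and independently of the budget, `c` halts with a value satisfying `P`. -/
def Runs {β : Type} (c : Comp β) (t : ℕ) (P : β → Prop) : Prop :=
  ∃ v, P v ∧ ∃ s ≤ t, ∀ r, c (s + r) = some (v, r)

section Rules

variable {β γ σ : Type}

theorem Runs.pure {P : β → Prop} {v : β} (t : ℕ) (h : P v) : Runs (Pure.pure v) t P :=
  ⟨v, h, 0, Nat.zero_le _, fun r => by simp [Pure.pure, StateT.pure]⟩

theorem Runs.mono {c : Comp β} {t t' : ℕ} {P Q : β → Prop} (h : Runs c t P) (ht : t ≤ t')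
    (hPQ : ∀ v, P v → Q v) : Runs c t' Q := by
  obtain ⟨v, hv, s, hs, hr⟩ := h
  exact ⟨v, hPQ v hv, s, hs.trans ht, hr⟩

theorem Runs.le {c : Comp β} {t t' : ℕ} {P : β → Prop} (h : Runs c t P) (ht : t ≤ t') :
    Runs c t' P := h.mono ht fun _ h => h

theorem Runs.bind {c : Comp β} {f : β → Comp γ} {t t' : ℕ} {P : β → Prop} {Q : γ → Prop}
    (h : Runs c t P) (hf : ∀ v, P v → Runs (f v) t' Q) : Runs (c >>= f) (t + t') Q := by
  obtain ⟨v, hv, s, hs, hr⟩ := h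
  obtain ⟨w, hw, s', hs', hr'⟩ := hf v hv
  refine ⟨w, hw, s + s', by omega, fun r => ?_⟩
  simp [Bind.bind, StateT.bind, add_assoc, hr, hr']

theorem Runs.tick_bind {f : Unit → Comp γ} {t : ℕ} {Q : γ → Prop} (h : Runs (f ()) t Q) :
    Runs (tick >>= f) (t + 1) Q := by
  have h1 : Runs tick 1 (fun _ => True) :=
    ⟨(), trivial, 1, le_rfl, fun r => by rw [Nat.add_comm]; rfl⟩
  rw [Nat.add_comm]
  exact h1.bind fun _ _ => h

theorem Runs.ite {p : Prop} [Decidable p] {c d : Comp β} {t : ℕ} {P : β → Prop}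
    (hc : p → Runs c t P) (hd : ¬p → Runs d t P) : Runs (if p then c else d) t P := by
  split_ifs with h
  exacts [hc h, hd h]

theorem Runs.haltsWithin {c : Comp β} {t : ℕ} {P : β → Prop} (h : Runs c t P) :
    ∃ v, P v ∧ HaltsWithin c t v := by
  obtain ⟨v, hv, s, hs, hr⟩ := h
  exact ⟨v, hv, t - s, by rw [← hr (t - s), Nat.add_sub_cancel' hs]⟩

/-- What one iteration of a loop has to establish: either the invariant is kept and the measure
drops, or the loop is left with the postcondition. -/
def Continues (I : σ → Prop) (μ : σ → ℕ) (Q : β → Prop) (m : ℕ) : σ ⊕ β → Prop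
  | .inl s => I s ∧ μ s < m
  | .inr v => Q v

/-- Induction on a bound for the measure. Fuel `j` and budget `c + r` are kept apart because the
recursive call lowers the fuel by one but the budget by a whole iteration. Since each iteration pays
a tick, `k ≤ c`. -/
theorem Runs.loopAux {f : σ → Comp (σ ⊕ β)} {I : σ → Prop} {μ : σ → ℕ} {Q : β → Prop} {t : ℕ}
    (hf : ∀ s, I s → Runs (f s) t (Continues I μ Q (μ s))) :
    ∀ (m : ℕ) (s : σ), I s → μ s ≤ m → ∃ v, Q v ∧ ∃ c ≤ (m + 1) * (t + 1), ∃ k ≤ c,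
      ∀ j, k ≤ j → ∀ r, loopAux f j s (c + r) = some (v, r) := by
  intro m
  induction m with
  | zero =>
    intro s hs hm
    obtain ⟨w, hw, c, hc, hr⟩ := hf s hs
    cases w with
    | inl s' => exact absurd hw.2 (by omega)
    | inr v =>
      refine ⟨v, hw, c + 1, by omega, 1, by omega, fun j hj r => ?_⟩
      obtain ⟨j, rfl⟩ := Nat.exists_eq_add_of_le' hj
      rw [show c + 1 + r = (c + r) + 1 by omega]
      simp [CNF.loopAux, Bind.bind, StateT.bind, tick, hr, Pure.pure, StateT.pure]
  | succ m ih =>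
    intro s hs hm
    obtain ⟨w, hw, c, hc, hr⟩ := hf s hs
    cases w with
    | inl s' =>
      obtain ⟨v, hv, c', hc', k, hk, hj⟩ := ih s' hw.1 (by have := hw.2; omega)
      refine ⟨v, hv, c + 1 + c', ?_, k + 1, by omega, fun j hkj r => ?_⟩
      · rw [Nat.succ_mul]; omega
      · obtain ⟨j, rfl⟩ := Nat.exists_eq_add_of_le' (show 1 ≤ j by omega)
        rw [show c + 1 + c' + r = (c + (c' + r)) + 1 by omega]
        simp [CNF.loopAux, Bind.bind, StateT.bind, tick, hr, hj j (by omega)]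
    | inr v =>
      refine ⟨v, hw, c + 1, ?_, 1, by omega, fun j hj r => ?_⟩
      · rw [Nat.succ_mul]; omega
      obtain ⟨j, rfl⟩ := Nat.exists_eq_add_of_le' hj
      rw [show c + 1 + r = (c + r) + 1 by omega]
      simp [CNF.loopAux, Bind.bind, StateT.bind, tick, hr, Pure.pure, StateT.pure]

/-- The cost of at most `n` iterations at cost `t` each. -/
def iter (n t : ℕ) : ℕ := (n + 1) * (t + 1)

theorem iter_mono {n n' t t' : ℕ} (hn : n ≤ n') (ht : t ≤ t') : iter n t ≤ iter n' t' :=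
  Nat.mul_le_mul (by omega) (by omega)

theorem iter_succ (n t : ℕ) : iter (n + 1) t = t + iter n t + 1 := by
  unfold iter; ring

theorem Runs.tick_pure {P : β → Prop} {v : β} {n t : ℕ} (h : P v) :
    Runs (do tick; Pure.pure v) (iter n t) P :=
  Runs.le (Runs.tick_bind (Runs.pure 0 h)) (Nat.mul_pos n.succ_pos t.succ_pos)

theorem Runs.loop {f : σ → Comp (σ ⊕ β)} (I : σ → Prop) (μ : σ → ℕ) {Q : β → Prop} {t m : ℕ}
    {s : σ} (hs : I s) (hm : μ s ≤ m)
    (hf : ∀ s, I s → Runs (f s) t (Continues I μ Q (μ s))) :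
    Runs (loop f s) (iter m t) Q := by
  obtain ⟨v, hv, c, hc, k, hk, hj⟩ := Runs.loopAux hf m s hs hm
  -- The budget `c + r` also serves as fuel, which suffices because `k ≤ c`.
  exact ⟨v, hv, c, hc, fun r => hj (c + r) (by omega) r⟩

theorem Runs.anyC {p : β → Comp Bool} {t : ℕ} (P : β → Prop) {l : List β} {n : ℕ}
    (hn : l.length ≤ n) (hp : ∀ x ∈ l, Runs (p x) t (fun b => b = true ↔ P x)) :
    Runs (anyC p l) (iter n t) (fun b => b = true ↔ ∃ x ∈ l, P x) := by
  refine Runs.le ?_ (iter_mono hn le_rfl)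
  clear hn
  induction l with
  | nil => exact Runs.tick_pure (by simp)
  | cons x l ih =>
    rw [List.length_cons, iter_succ]
    refine Runs.tick_bind ((hp x (by simp)).bind fun b hb => Runs.ite (fun h => ?_) fun h => ?_)
    · exact Runs.pure _ (by simp [hb.1 h])
    · refine (ih fun y hy => hp y (by simp [hy])).mono le_rfl fun v hv => ?_
      rw [hv]; simp [mt hb.2 h]

theorem Runs.allC {p : β → Comp Bool} {t : ℕ} (P : β → Prop) {l : List β} {n : ℕ}
    (hn : l.length ≤ n) (hp : ∀ x ∈ l, Runs (p x) t (fun b => b = true ↔ P x)) :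
    Runs (allC p l) (iter n t) (fun b => b = true ↔ ∀ x ∈ l, P x) := by
  refine Runs.le ?_ (iter_mono hn le_rfl)
  clear hn
  induction l with
  | nil => exact Runs.tick_pure (by simp)
  | cons x l ih =>
    rw [List.length_cons, iter_succ]
    refine Runs.tick_bind ((hp x (by simp)).bind fun b hb => Runs.ite (fun h => ?_) fun h => ?_)
    · refine (ih fun y hy => hp y (by simp [hy])).mono le_rfl fun v hv => ?_
      rw [hv]; simp [hb.1 h]
    · exact Runs.pure _ (by simp [mt hb.2 h])

/-- `r` splits `l` into the elements that satisfy `P` and those that do not. -/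
structure IsSplit (P : β → Prop) (l : List β) (r : List β × List β) : Prop where
  fst_sublist : r.1.Sublist l
  snd_sublist : r.2.Sublist l
  length_add : r.1.length + r.2.length = l.length
  mem_fst : ∀ x, x ∈ r.1 ↔ x ∈ l ∧ P x
  mem_snd : ∀ x, x ∈ r.2 ↔ x ∈ l ∧ ¬P x

theorem Runs.splitC {p : β → Comp Bool} {t : ℕ} (P : β → Prop) {l : List β} {n : ℕ}
    (hn : l.length ≤ n) (hp : ∀ x ∈ l, Runs (p x) t (fun b => b = true ↔ P x)) :
    Runs (splitC p l) (iter n t) (IsSplit P l) := by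
  refine Runs.le ?_ (iter_mono hn le_rfl)
  clear hn
  induction l with
  | nil => exact Runs.tick_pure (by constructor <;> simp)
  | cons x l ih =>
    -- The summands are swapped because `splitC` treats the tail before it tests `x`.
    rw [List.length_cons, iter_succ, add_comm t]
    refine Runs.tick_bind ((ih fun y hy => hp y (by simp [hy])).bind fun r hr => ?_)
    -- What follows is free; charging it `0` makes the total definitionally equal to `t`. The same
    -- device recurs below.
    refine Runs.bind (t' := 0) (hp x (by simp)) fun b hb => Runs.ite (fun h => ?_) fun h => ?_
    · have hx := hb.1 h
      refine Runs.pure _ ⟨hr.1.cons_cons x, hr.2.cons x, ?_, fun y => ?_, fun y => ?_⟩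
      · have := hr.3; simp; omega
      · have := hr.4 y; simp only [List.mem_cons, this]; grind
      · have := hr.5 y; simp only [List.mem_cons, this]; grind
    · have hx := mt hb.2 h
      refine Runs.pure _ ⟨hr.1.cons x, hr.2.cons_cons x, ?_, fun y => ?_, fun y => ?_⟩
      · have := hr.3; simp; omega
      · have := hr.4 y; simp only [List.mem_cons, this]; grind
      · have := hr.5 y; simp only [List.mem_cons, this]; grind

/-- `r` is the sublist of the elements of `l` that satisfy `P`. -/
structure IsFilter (P : β → Prop) (l r : List β) : Prop where
  sublist : r.Sublist l
  mem : ∀ x, x ∈ r ↔ x ∈ l ∧ P x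

theorem Runs.filterC {p : β → Comp Bool} {t : ℕ} (P : β → Prop) {l : List β} {n : ℕ}
    (hn : l.length ≤ n) (hp : ∀ x ∈ l, Runs (p x) t (fun b => b = true ↔ P x)) :
    Runs (filterC p l) (iter n t) (IsFilter P l) :=
  Runs.bind (t' := 0) (Runs.splitC P hn hp) fun _ hr => Runs.pure _ ⟨hr.1, hr.4⟩

/-- `r` is obtained from `l` by replacing each element by one related to it. -/
structure IsMap (R : β → γ → Prop) (l : List β) (r : List γ) : Prop where
  length_eq : r.length = l.length
  exists_source : ∀ y ∈ r, ∃ x ∈ l, R x y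
  exists_target : ∀ x ∈ l, ∃ y ∈ r, R x y

theorem Runs.mapC {f : β → Comp γ} {t : ℕ} (R : β → γ → Prop) {l : List β} {n : ℕ}
    (hn : l.length ≤ n) (hf : ∀ x ∈ l, Runs (f x) t (R x)) :
    Runs (mapC f l) (iter n t) (IsMap R l) := by
  refine Runs.le ?_ (iter_mono hn le_rfl)
  clear hn
  induction l with
  | nil => exact Runs.tick_pure (by constructor <;> simp)
  | cons x l ih =>
    rw [List.length_cons, iter_succ]
    refine Runs.tick_bind ((hf x (by simp)).bind fun y hy => ?_)
    refine Runs.bind (t' := 0) (ih fun y hy => hf y (by simp [hy])) fun r hr => Runs.pure _ ?_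
    refine ⟨by simp [hr.1], ?_, ?_⟩
    · have := hr.2; simp; grind
    · have := hr.3; simp; grind

theorem Runs.foldC {f : γ → β → Comp γ} {t : ℕ} (I : List β → γ → Prop) {l : List β} {n : ℕ}
    {z : γ} (hn : l.length ≤ n) (hz : I [] z)
    (hf : ∀ pre z x, x ∈ l → I pre z → Runs (f z x) t (I (pre ++ [x]))) :
    Runs (foldC f z l) (iter n t) (I l) := by
  refine Runs.le ?_ (iter_mono hn le_rfl)
  clear hn
  -- Generalized to an arbitrary prefix already processed, since the invariant speaks of that
  -- prefix.
  suffices ∀ pre, I pre z → Runs (CNF.foldC f z l) (iter l.length t) (I (pre ++ l)) by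
    simpa using this [] hz
  clear hz
  induction l generalizing z with
  | nil => exact fun pre hz => Runs.tick_pure (by simpa using hz)
  | cons x l ih =>
    intro pre hz
    rw [List.length_cons, iter_succ]
    refine Runs.tick_bind ((hf pre z x (by simp) hz).bind fun z' hz' => ?_)
    have := ih (fun pre z y hy => hf pre z y (by simp [hy])) (z := z') (pre ++ [x]) hz'
    simpa using this

theorem Runs.pick {x : β} {l : List β} {k n : ℕ} (hn : l.length ≤ n) :
    Runs (pick x l k) (iter n 0) (fun y => y ∈ x :: l) := by
  refine Runs.le ?_ (iter_mono hn le_rfl)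
  clear hn
  induction l generalizing x k with
  | nil => exact Runs.tick_pure (by simp)
  | cons y l ih =>
    cases k with
    | zero => exact Runs.tick_pure (by simp)
    | succ k =>
      rw [List.length_cons, iter_succ, Nat.zero_add]
      exact Runs.tick_bind (ih.mono le_rfl fun v hv => List.mem_cons_of_mem x hv)

end Rules

/-! ## Finite sets of atoms -/

section Sets

variable {α : Type}

/-- A list without repetitions of elements of the universe `U`. -/
structure AtomSet (U X : List α) : Prop where
  nodup : X.Nodup
  subset : X ⊆ U

/-- This lets one number `n` bound every atom set that is built incrementally; `U` itself may
contain repetitions. -/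
theorem AtomSet.length_le {U X : List α} {n : ℕ} (h : AtomSet U X) (hU : U.length ≤ n) :
    X.length ≤ n :=
  (h.nodup.subperm h.subset).length_le.trans hU

theorem AtomSet.nil {U : List α} : AtomSet U [] := ⟨List.nodup_nil, by simp⟩

theorem AtomSet.cons {U X : List α} {a : α} (h : AtomSet U X) (ha : a ∈ U) (haX : a ∉ X) :
    AtomSet U (a :: X) :=
  ⟨List.nodup_cons.2 ⟨haX, h.nodup⟩, List.cons_subset.2 ⟨ha, h.subset⟩⟩

theorem AtomSet.sublist {U X Y : List α} (h : AtomSet U X) (hYX : Y.Sublist X) : AtomSet U Y :=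
  ⟨hYX.nodup h.nodup, fun _ ha => h.subset (hYX.subset ha)⟩

/-- Supplies the strict progress of all loops whose measure is the size of an atom set or its
complement to `n`. -/
theorem length_lt_of_subset {X Y : List α} {a : α} (hX : X.Nodup) (hXY : X ⊆ Y) (ha : a ∈ Y)
    (haX : a ∉ X) : X.length < Y.length :=
  ((List.nodup_cons.2 ⟨haX, hX⟩).subperm (List.cons_subset.2 ⟨ha, hXY⟩)).length_le

/-- All atom lists of a clause consist of at most `n` elements of `U`. -/
structure Clause.Within (U : List α) (n : ℕ) (c : Clause α) : Prop where
  head_length : c.head.length ≤ n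
  body_length : c.body.length ≤ n
  head_subset : c.head ⊆ U
  body_subset : c.body ⊆ U

/-- A theory with at most `n` clauses, all with at most `n` head and body atoms from `U`. -/
structure Theory.Within (U : List α) (n : ℕ) (T : Theory α) : Prop where
  length_le : T.length ≤ n
  clause : ∀ c ∈ T, c.Within U n

theorem Theory.Within.sublist {U : List α} {n : ℕ} {T T' : Theory α} (h : T.Within U n)
    (hT : List.Sublist T' T) : T'.Within U n :=
  ⟨hT.length_le.trans h.1, fun c hc => h.2 c (hT.subset hc)⟩

/-- The cost of an operation that goes through a list for each element of another one. -/
def setCost (n : ℕ) : ℕ := iter n (iter n 1)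

variable {U : List α} {n : ℕ}

/-- `c'` has the head atoms of `c` in `X` and the body atoms of `c` in `Y`. -/
structure Clause.IsProj (X Y : Set α) (c c' : Clause α) : Prop where
  mem_head : ∀ a, a ∈ c'.head ↔ a ∈ c.head ∧ a ∈ X
  mem_body : ∀ a, a ∈ c'.body ↔ a ∈ c.body ∧ a ∈ Y

/-- `T'` consists of the projections to `X` and `Y` of those clauses of `T` that have a head atom
in `X`. -/
structure Theory.IsProj (X Y : Set α) (T T' : Theory α) : Prop where
  exists_source : ∀ c' ∈ T', ∃ c ∈ T, c.IsProj X Y c' ∧ c'.head ≠ []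
  exists_target : ∀ c ∈ T, (∃ a ∈ c.head, a ∈ X) → ∃ c' ∈ T', c.IsProj X Y c'

theorem runs_filterC_hasHeadC {T T' : Theory α} {X Y : Set α} (hT : T.Within U n)
    (h : IsMap (fun c c' : Clause α =>
      c.IsProj X Y c' ∧ c'.head.Sublist c.head ∧ c'.body.Sublist c.body) T T') :
    Runs (filterC hasHeadC T') (iter n 1) (fun r => T.IsProj X Y r ∧ Theory.Within U n r) := by
  have hlen : List.length T' ≤ n := h.1.trans_le hT.1
  refine (Runs.filterC (fun c => c.head ≠ []) hlen fun c _ =>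
    Runs.tick_bind (t := 0) (Runs.pure _ (by simp))).mono le_rfl fun r hr => ⟨⟨?_, ?_⟩, ?_, ?_⟩
  · intro c' hc'
    obtain ⟨h1, h2⟩ := (hr.2 c').1 hc'
    obtain ⟨c, hc, h3, -⟩ := h.2 c' h1
    exact ⟨c, hc, h3, h2⟩
  · rintro c hc ⟨a, ha, haX⟩
    obtain ⟨c', hc', h3, -⟩ := h.3 c hc
    exact ⟨c', (hr.2 c').2 ⟨hc', List.ne_nil_of_mem ((h3.1 a).2 ⟨ha, haX⟩)⟩, h3⟩
  · exact hr.1.length_le.trans hlen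
  · intro c' hc'
    obtain ⟨c, hc, -, h3, h4⟩ := h.2 c' (hr.1.subset hc')
    have hcw := hT.2 c hc
    exact ⟨h3.length_le.trans hcw.1, h4.length_le.trans hcw.2,
      fun _ ha => hcw.3 (h3.subset ha), fun _ ha => hcw.4 (h4.subset ha)⟩

variable [DecidableEq α]

theorem runs_eqC (a b : α) : Runs (eqC a b) 1 (fun r => r = true ↔ a = b) :=
  Runs.tick_bind (t := 0) (Runs.pure _ (by simp))

theorem runs_memC {a : α} {X : List α} {n : ℕ} (hX : X.length ≤ n) :
    Runs (memC a X) (iter n 1) (fun r => r = true ↔ a ∈ X) :=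
  (Runs.anyC (fun b => a = b) hX fun b _ => runs_eqC a b).mono le_rfl (by simp)

theorem runs_subsetC {X Y : List α} {n : ℕ} (hX : X.length ≤ n) (hY : Y.length ≤ n) :
    Runs (subsetC X Y) (setCost n) (fun r => r = true ↔ ∀ a ∈ X, a ∈ Y) :=
  Runs.allC _ hX fun _ _ => runs_memC hY

theorem runs_meetsC {X Y : List α} {n : ℕ} (hX : X.length ≤ n) (hY : Y.length ≤ n) :
    Runs (meetsC X Y) (setCost n) (fun r => r = true ↔ ∃ a ∈ X, a ∈ Y) :=
  Runs.anyC _ hX fun _ _ => runs_memC hY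

theorem runs_ssupsetC {X Y : List α} {n : ℕ} (hX : X.length ≤ n) (hY : Y.length ≤ n) :
    Runs (ssupsetC X Y) (setCost n + setCost n)
      (fun r => r = true ↔ (∀ a ∈ Y, a ∈ X) ∧ ¬∀ a ∈ X, a ∈ Y) :=
  (runs_subsetC hY hX).bind fun p hp =>
    Runs.bind (t' := 0) (runs_subsetC hX hY) fun q hq => Runs.pure _ (by
      rw [← hp, ← hq]; simp)

theorem runs_interC {X Y : List α} {n : ℕ} (hX : X.length ≤ n) (hY : Y.length ≤ n) :
    Runs (interC X Y) (setCost n) (IsFilter (· ∈ Y) X) :=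
  Runs.filterC _ hX fun _ _ => runs_memC hY

theorem runs_diffC {X Y : List α} {n : ℕ} (hX : X.length ≤ n) (hY : Y.length ≤ n) :
    Runs (diffC X Y) (setCost n) (IsFilter (· ∉ Y) X) :=
  Runs.bind (t' := 0) (Runs.splitC (· ∈ Y) hX fun _ _ => runs_memC hY)
    fun _ hr => Runs.pure _ ⟨hr.2, hr.5⟩

theorem runs_insertC {U X : List α} {a : α} {n : ℕ} (hU : U.length ≤ n) (hX : AtomSet U X)
    (ha : a ∈ U) :
    Runs (insertC X a) (iter n 1) (fun r => AtomSet U r ∧ ∀ b, b ∈ r ↔ b ∈ X ∨ b = a) :=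
  Runs.bind (t' := 0) (runs_memC (hX.length_le hU)) fun _ hb => Runs.ite
    (fun h => Runs.pure _ ⟨hX, fun b => by have := hb.1 h; grind⟩)
    (fun h => Runs.pure _ ⟨hX.cons ha (mt hb.2 h), by simp [or_comm]⟩)

theorem runs_unionC {U X Y : List α} {n : ℕ} (hU : U.length ≤ n) (hX : AtomSet U X)
    (hY : Y ⊆ U) (hYn : Y.length ≤ n) :
    Runs (unionC X Y) (setCost n) (fun r => AtomSet U r ∧ ∀ b, b ∈ r ↔ b ∈ X ∨ b ∈ Y) := by
  refine Runs.foldC (fun pre r => AtomSet U r ∧ ∀ b, b ∈ r ↔ b ∈ X ∨ b ∈ pre) hYn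
    ⟨hX, by simp⟩ fun pre r a ha hr => ?_
  refine (runs_insertC hU hr.1 (hY ha)).mono le_rfl fun r' hr' => ⟨hr'.1, fun b => ?_⟩
  rw [hr'.2, hr.2]; simp [or_assoc]

/-! ## Operations on theories -/

theorem runs_headsC {T : Theory α} (hU : U.length ≤ n) (hT : T.Within U n) :
    Runs (headsC T) (iter n (setCost n))
      (fun r => AtomSet U r ∧ ∀ a, a ∈ r ↔ ∃ c ∈ T, a ∈ c.head) := by
  refine Runs.foldC (fun (pre : Theory α) r => AtomSet U r ∧ ∀ a, a ∈ r ↔ ∃ c ∈ pre, a ∈ c.head)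
    hT.1 ⟨AtomSet.nil, by simp⟩ fun pre r c hc hr => ?_
  have hcw := hT.2 c hc
  refine (runs_unionC hU hr.1 hcw.3 hcw.1).mono le_rfl fun r' hr' => ⟨hr'.1, fun b => ?_⟩
  rw [hr'.2, hr.2]; grind

theorem runs_atomsC {T : Theory α} (hU : U.length ≤ n) (hT : T.Within U n) :
    Runs (atomsC T) (iter n (setCost n + setCost n))
      (fun r => AtomSet U r ∧ ∀ a, a ∈ r ↔ a ∈ T.atoms) := by
  refine Runs.foldC (fun (pre : Theory α) r => AtomSet U r ∧ ∀ a, a ∈ r ↔ a ∈ Theory.atoms pre)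
    hT.1 ⟨AtomSet.nil, by simp [Theory.atoms]⟩ fun pre r c hc hr => ?_
  have hcw := hT.2 c hc
  refine (runs_unionC hU hr.1 hcw.3 hcw.1).bind fun r' hr' => ?_
  refine (runs_unionC hU hr'.1 hcw.4 hcw.2).mono le_rfl fun r'' hr'' => ⟨hr''.1, fun b => ?_⟩
  rw [hr''.2, hr'.2, hr.2]
  simp only [Theory.atoms, Clause.H, Clause.B, Set.mem_ofPred_eq]; grind

theorem runs_holdsC {c : Clause α} {I : List α} (hc : c.Within U n) (hI : I.length ≤ n) :
    Runs (holdsC c I) (setCost n + setCost n) (fun r => r = true ↔ c.Holds {a | a ∈ I}) := by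
  refine (runs_subsetC hc.2 hI).bind fun b hb => Runs.ite (fun h => ?_) fun h => ?_
  · refine (runs_meetsC hc.1 hI).mono le_rfl fun r hr => ?_
    have := hb.1 h
    rw [hr]; simp only [Clause.Holds, Clause.H, Clause.B, Set.mem_ofPred_eq]; grind
  · refine Runs.pure _ ?_
    have := mt hb.2 h
    simp only [Clause.Holds, Clause.H, Clause.B, Set.mem_ofPred_eq]; grind

/-- The clauses of `T` are true in `I`. -/
def Theory.Holds (T : Theory α) (I : Set α) : Prop := ∀ c ∈ T, c.Holds I

theorem runs_isModelC {T : Theory α} {I : List α} (hT : T.Within U n) (hI : I.length ≤ n) :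
    Runs (isModelC T I) (iter n (setCost n + setCost n))
      (fun r => r = true ↔ T.Holds {a | a ∈ I}) :=
  Runs.allC _ hT.1 fun c hc => runs_holdsC (hT.2 c hc) hI

/-- The head consists of at most one atom. -/
def Clause.IsHorn (c : Clause α) : Prop := ∀ a ∈ c.head, ∀ b ∈ c.head, a = b

theorem runs_isHornC {c : Clause α} (hc : c.Within U n) :
    Runs (isHornC c) (iter n 1) (fun r => r = true ↔ c.IsHorn) := by
  obtain ⟨hd, bd⟩ := c
  have hn := hc.1
  cases hd with
  | nil => exact Runs.tick_pure (by simp [Clause.IsHorn])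
  | cons h l =>
    refine (Runs.allC (fun a => h = a) (by simp at hn; omega) fun a _ => runs_eqC h a).mono le_rfl
      fun r hr => ?_
    rw [hr]
    refine ⟨fun H => ?_, fun H a ha => H h (by simp) a (by simp [ha])⟩
    have : ∀ a ∈ h :: l, h = a := by simpa using H
    exact fun a ha b hb => (this a ha).symm.trans (this b hb)

theorem runs_ndC {T : Theory α} (hT : T.Within U n) :
    Runs (ndC T) (iter n (iter n 1)) (IsFilter Clause.IsHorn T) :=
  Runs.filterC _ hT.1 fun c hc => runs_isHornC (hT.2 c hc)

def projCost (n : ℕ) : ℕ := iter n (setCost n + setCost n) + iter n 1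

theorem runs_projHeadC {T : Theory α} {X : List α} (hT : T.Within U n) (hX : X.length ≤ n) :
    Runs (projHeadC T X) (projCost n)
      (fun r => T.IsProj {a | a ∈ X} Set.univ r ∧ Theory.Within U n r) := by
  refine Runs.bind (Runs.mapC _ hT.1 fun c hc => ?_) fun T' hT' => runs_filterC_hasHeadC hT hT'
  refine (runs_interC (hT.2 c hc).1 hX).bind fun r hr => Runs.pure _ ?_
  exact ⟨⟨hr.2, by simp⟩, hr.1, .refl _⟩

theorem runs_projC {T : Theory α} {X : List α} (hT : T.Within U n) (hX : X.length ≤ n) :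
    Runs (projC T X) (projCost n)
      (fun r => T.IsProj {a | a ∈ X} {a | a ∈ X} r ∧ Theory.Within U n r) := by
  refine Runs.bind (Runs.mapC _ hT.1 fun c hc => ?_) fun T' hT' => runs_filterC_hasHeadC hT hT'
  refine (runs_interC (hT.2 c hc).1 hX).bind fun r hr => ?_
  refine Runs.bind (t' := 0) (runs_interC (hT.2 c hc).2 hX) fun r' hr' => Runs.pure _ ?_
  exact ⟨⟨hr.2, hr'.2⟩, hr.1, hr'.1⟩

/-! ## Steady sets -/

/-- `S` is the least model of `T`. -/
structure IsLeastModel (T : Theory α) (S : List α) : Prop where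
  holds : T.Holds {a | a ∈ S}
  least : ∀ I : Set α, T.Holds I → ∀ a ∈ S, a ∈ I

def leastModelCost (n : ℕ) : ℕ :=
  iter n (iter n (setCost n + setCost n) + (iter n (setCost n) + setCost n))

/-- The invariant is that `S` lies in every set satisfying `T`. A clause false in `S` has its body
in `S`, so any such set must contain its only head atom. Non-empty heads make every pass add an
atom. -/
theorem runs_leastModelC {T : Theory α} (hU : U.length ≤ n) (hT : T.Within U n)
    (hhead : ∀ c ∈ T, c.head ≠ []) (hhorn : ∀ c ∈ T, c.IsHorn) :
    Runs (leastModelC T) (leastModelCost n) (fun S => AtomSet U S ∧ IsLeastModel T S) := by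
  refine Runs.loop (fun S => AtomSet U S ∧ ∀ I : Set α, T.Holds I → ∀ a ∈ S, a ∈ I)
    (fun S => n - S.length) ⟨AtomSet.nil, by simp⟩ (Nat.sub_le _ _) fun S ⟨hS, hleast⟩ => ?_
  have hSn := hS.length_le hU
  refine Runs.bind (Runs.filterC (fun c => ¬c.Holds {a | a ∈ S}) hT.1 fun c hc =>
    Runs.bind (t' := 0) (runs_holdsC (hT.2 c hc) hSn) fun b hb => Runs.pure _ (by simp [← hb]))
    fun F hF => Runs.ite (fun h => Runs.pure _ ?_) fun h => ?_
  · refine ⟨hS, fun c hc => ?_, hleast⟩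
    by_contra hcon
    have := (hF.2 c).2 ⟨hc, hcon⟩
    simp_all
  · have hFw := hT.sublist hF.1
    refine Runs.bind (runs_headsC hU hFw) fun A hA => Runs.bind (t' := 0)
      (runs_unionC hU hS hA.1.2 (hA.1.length_le hU)) fun S' hS' => Runs.pure _
        ⟨⟨hS'.1, fun I hI a ha => ?_⟩, ?_⟩
    · rcases (hS'.2 a).1 ha with ha | ha
      · exact hleast I hI a ha
      · obtain ⟨c, hc, hac⟩ := (hA.2 a).1 ha
        obtain ⟨hcT, hcS⟩ := (hF.2 c).1 hc
        rcases hI c hcT with ⟨b, hb, hbI⟩ | ⟨b, hb, hbI⟩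
        · rwa [hhorn c hcT a hac b hb]
        · exact absurd (.inr ⟨b, hb, fun h => hbI (hleast I hI b h)⟩) hcS
    · obtain ⟨c, hc⟩ := List.exists_mem_of_ne_nil F (by simpa using h)
      obtain ⟨hcT, hcS⟩ := (hF.2 c).1 hc
      obtain ⟨a, ha⟩ := List.exists_mem_of_ne_nil _ (hhead c hcT)
      have h1 := length_lt_of_subset hS.1 (fun b hb => (hS'.2 b).2 (.inl hb))
        ((hS'.2 a).2 (.inr ((hA.2 a).2 ⟨c, hc, ha⟩))) (fun h => hcS (.inl ⟨a, ha, h⟩))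
      have h2 := hS'.1.length_le hU
      change n - S'.length < n - S.length
      omega

/-- `S` is the steady set of `M` for `T`. -/
structure IsSteady (T : Theory α) (M S : List α) : Prop where
  subset : ∀ a ∈ S, a ∈ M
  closed : ∀ c ∈ T, ∀ h ∈ c.head, h ∈ M → (∀ h' ∈ c.head, h' ∈ M → h' = h) →
    (∀ b ∈ c.body, b ∈ S) → h ∈ S
  least : ∀ I : Set α, I ⊆ {a | a ∈ M} → T.Holds I → ∀ a ∈ S, a ∈ I

def steadyCost (n : ℕ) : ℕ := projCost n + (iter n (iter n 1) + leastModelCost n)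

theorem runs_steadyC {T : Theory α} {M : List α} (hU : U.length ≤ n) (hT : T.Within U n)
    (hM : M.length ≤ n) :
    Runs (steadyC T M) (steadyCost n) (fun S => AtomSet U S ∧ IsSteady T M S) := by
  refine Runs.bind (runs_projHeadC hT hM) fun P hP => Runs.bind (runs_ndC hP.2) fun N hN => ?_
  have hNw := hP.2.sublist hN.1
  refine (runs_leastModelC hU hNw ?_ ?_).mono le_rfl fun S hS => ⟨hS.1, ?_, ?_, ?_⟩
  · intro c hc
    obtain ⟨_, _, _, h⟩ := hP.1.1 c (hN.1.subset hc)
    exact h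
  · exact fun c hc => ((hN.2 c).1 hc).2
  -- The set `M` satisfies the reduced theory, whose heads are non-empty and inside `M`; leastness
  -- then puts `S` inside `M`.
  · refine hS.2.2 {a | a ∈ M} fun c hc => ?_
    obtain ⟨c', -, h, hne⟩ := hP.1.1 c (hN.1.subset hc)
    obtain ⟨a, ha⟩ := List.exists_mem_of_ne_nil _ hne
    exact .inl ⟨a, ha, ((h.1 a).1 ha).2⟩
  · intro c hc h hh hhM huniq hbody
    obtain ⟨c', hc', hp⟩ := hP.1.2 c hc ⟨h, hh, hhM⟩
    have hhead : ∀ a ∈ c'.head, a = h := fun a ha =>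
      huniq a ((hp.1 a).1 ha).1 ((hp.1 a).1 ha).2
    have hc'N : c' ∈ N := (hN.2 c').2 ⟨hc', fun a ha b hb => by rw [hhead a ha, hhead b hb]⟩
    rcases hS.2.1 c' hc'N with ⟨a, ha, haS⟩ | ⟨b, hb, hbS⟩
    · rwa [← hhead a ha]
    · exact absurd (hbody b ((hp.2 b).1 hb).1) hbS
  · intro I hIM hI
    refine hS.2.2 I fun c hc => ?_
    obtain ⟨c', hc', h, -⟩ := hP.1.1 c (hN.1.subset hc)
    rcases hI c' hc' with ⟨a, ha, haI⟩ | ⟨b, hb, hbI⟩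
    · exact .inl ⟨a, (h.1 a).2 ⟨ha, hIM haI⟩, haI⟩
    · exact .inr ⟨b, (h.2 b).2 ⟨hb, trivial⟩, hbI⟩

/-- `Q` is the simplified theory of `T` with respect to `M`, whose steady set is `S`. -/
structure IsSimplified (T : Theory α) (M S : List α) (Q : Theory α) : Prop where
  exists_source : ∀ q ∈ Q, ∃ c ∈ T, (∀ h ∈ c.head, h ∉ S) ∧ (∀ b ∈ c.body, b ∈ M) ∧
    c.IsProj {a | a ∈ M ∧ a ∉ S} {a | a ∈ M ∧ a ∉ S} q ∧ q.head ≠ []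
  exists_target : ∀ c ∈ T, (∀ h ∈ c.head, h ∉ S) → (∀ b ∈ c.body, b ∈ M) →
    (∃ h ∈ c.head, h ∈ M) → ∃ q ∈ Q, c.IsProj {a | a ∈ M ∧ a ∉ S} {a | a ∈ M ∧ a ∉ S} q

def simplifiedCost (n : ℕ) : ℕ := iter n (setCost n + setCost n) + (setCost n + projCost n)

theorem runs_simplifiedC {T : Theory α} {M S : List α} (hT : T.Within U n)
    (hM : M.length ≤ n) (hS : S.length ≤ n) :
    Runs (simplifiedC T M S) (simplifiedCost n)
      (fun Q => IsSimplified T M S Q ∧ Theory.Within U n Q) := by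
  refine Runs.bind (Runs.filterC
    (fun c => (∀ h ∈ c.head, h ∉ S) ∧ ∀ b ∈ c.body, b ∈ M) hT.1 fun c hc => ?_) fun F hF => ?_
  · have hcw := hT.2 c hc
    refine (runs_meetsC hcw.1 hS).bind fun b hb => Runs.ite (fun h => Runs.pure _ ?_) fun h => ?_
    · have := hb.1 h; grind
    · have := mt hb.2 h
      refine (runs_subsetC hcw.2 hM).mono le_rfl fun b hb => ?_
      rw [hb]; grind
  · refine (runs_diffC hM hS).bind fun R hR => ?_
    have hset : {a | a ∈ R} = {a | a ∈ M ∧ a ∉ S} := Set.ext hR.2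
    refine (runs_projC (hT.sublist hF.1) (hR.1.length_le.trans hM)).mono le_rfl
      fun Q hQ => ⟨⟨?_, ?_⟩, hQ.2⟩
    · intro q hq
      obtain ⟨c, hc, h⟩ := hQ.1.1 q hq
      obtain ⟨h1, h2, h3⟩ := (hF.2 c).1 hc
      exact ⟨c, h1, h2, h3, hset ▸ h.1, h.2⟩
    · rintro c hc h1 h2 ⟨h, hh, hhM⟩
      have := hQ.1.2 c ((hF.2 c).2 ⟨hc, h1, h2⟩) ⟨h, hh, hset ▸ ⟨hhM, h1 h hh⟩⟩
      rwa [hset] at this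

end Sets

/-! ## Directed graphs given by their arcs -/

section Graphs

variable {α : Type}

/-- There is a walk from `a` to `b` along the arcs in `E`. -/
def Reach (E : List (α × α)) (a b : α) : Prop := Relation.ReflTransGen (fun x y => (x, y) ∈ E) a b

theorem Reach.mem_of_mem {E : List (α × α)} {Z : Set α} (hZ : ∀ e ∈ E, e.2 ∈ Z → e.1 ∈ Z) {a b : α}
    (h : Reach E a b) (hb : b ∈ Z) : a ∈ Z := by
  induction h with
  | refl => exact hb
  | tail _ hbc ih => exact ih (hZ _ hbc hb)

theorem Reach.mem_of_closed {E : List (α × α)} {Z : Set α} (hZ : ∀ e ∈ E, e.1 ∈ Z → e.2 ∈ Z)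
    {a b : α} (h : Reach E a b) (ha : a ∈ Z) : b ∈ Z := by
  induction h with
  | refl => exact ha
  | tail _ hbc ih => exact hZ _ hbc ih

/-- All nodes reachable from `a` lie in `X` and reach `a`: the node `a` lies in a strongly connected
component without arcs to other components. -/
def IsTerminal (E : List (α × α)) (X : List α) (a : α) : Prop :=
  ∀ b, Reach E a b → b ∈ X ∧ Reach E b a

/-- A node with the fewest reachable nodes works: any node it reaches has a reachable set that is
contained in its own and no smaller, hence equal, and so reaches it back. -/
theorem exists_isTerminal {E : List (α × α)} {X : List α} (hE : ∀ e ∈ E, e.1 ∈ X ∧ e.2 ∈ X)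
    (hX : X ≠ []) : ∃ a ∈ X, IsTerminal E X a := by
  classical
  have hsub : ∀ a ∈ X, {b | Reach E a b} ⊆ (X.toFinset : Set α) := fun a ha b hb => by
    simpa using hb.mem_of_closed (Z := {x | x ∈ X}) (fun e he _ => (hE e he).2) ha
  obtain ⟨a, ha, hmin⟩ := Finset.exists_min_image X.toFinset
    (fun a => Set.ncard {b | Reach E a b}) (by simpa using hX)
  rw [List.mem_toFinset] at ha
  refine ⟨a, ha, fun b hb => ?_⟩
  have hbX : b ∈ X := by simpa using hsub a ha hb
  refine ⟨hbX, ?_⟩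
  have heq : {c | Reach E b c} = {c | Reach E a c} :=
    Set.eq_of_subset_of_ncard_le (fun c hc => Relation.ReflTransGen.trans hb hc)
      (hmin b (by simpa using hbX)) (X.toFinset.finite_toSet.subset (hsub a ha))
  have : a ∈ {c | Reach E a c} := Relation.ReflTransGen.refl
  rwa [← heq] at this

variable {U : List α} {n : ℕ}

/-- Arcs are prepended without a membership test, so the length bound counts repetitions: at most `n
* n` new entries per clause. -/
theorem runs_addArcs {C : Theory α} {E : List (α × α)} (hC : Theory.Within U n C) :
    Runs (foldC (fun E c =>
        foldC (fun E h => foldC (fun E b => (pure ((b, h) :: E) : Comp _)) E c.body) E c.head) E C)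
      (iter n (iter n (iter n 0)))
      (fun E' => E'.length ≤ E.length + C.length * (n * n) ∧
        ∀ e, e ∈ E' ↔ e ∈ E ∨ ∃ c ∈ C, e.1 ∈ c.body ∧ e.2 ∈ c.head) := by
  refine Runs.foldC (fun (pre : Theory α) (E' : List (α × α)) =>
    E'.length ≤ E.length + pre.length * (n * n) ∧
    ∀ e, e ∈ E' ↔ e ∈ E ∨ ∃ c ∈ pre, e.1 ∈ c.body ∧ e.2 ∈ c.head) hC.1 (by simp)
    fun pre E₁ c hc h₁ => ?_
  have hcw := hC.2 c hc
  refine (Runs.foldC (fun pre (E' : List (α × α)) => E'.length ≤ E₁.length + pre.length * n ∧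
    ∀ e, e ∈ E' ↔ e ∈ E₁ ∨ (e.1 ∈ c.body ∧ e.2 ∈ pre)) hcw.1 (by simp)
    fun pre E₂ h hh h₂ => ?_).mono le_rfl fun E' hE' => ⟨?_, fun e => ?_⟩
  · refine (Runs.foldC (fun pre (E' : List (α × α)) => E'.length ≤ E₂.length + pre.length ∧
      ∀ e, e ∈ E' ↔ e ∈ E₂ ∨ (e.1 ∈ pre ∧ e.2 = h)) hcw.2 (by simp)
      fun pre E₃ b hb h₃ => Runs.pure _ ⟨?_, fun e => ?_⟩).mono le_rfl
      fun E' hE' => ⟨?_, fun e => ?_⟩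
    · simp; omega
    · have := h₃.2 e
      obtain ⟨e1, e2⟩ := e
      simp only [List.mem_cons, this, Prod.mk.injEq, List.mem_append]; grind
    · have := hE'.1
      have := hcw.2
      simp only [List.length_append, List.length_singleton, add_mul, one_mul]; omega
    · rw [hE'.2, h₂.2]; grind
  · have h3 := hE'.1
    have h4 := Nat.mul_le_mul_right n hcw.1
    simp only [List.length_append, List.length_singleton, add_mul, one_mul]; omega
  · rw [hE'.2, h₁.2]; grind

variable [DecidableEq α]

/-- A list of at most `n ^ 3` arcs between elements of `U`. -/
structure ArcList (U : List α) (n : ℕ) (E : List (α × α)) : Prop where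
  length_le : E.length ≤ n * (n * n)
  subset : ∀ e ∈ E, e.1 ∈ U ∧ e.2 ∈ U

def reachCost (n : ℕ) : ℕ :=
  iter n (iter (n * (n * n)) (iter n 1 + iter n 1) + iter (n * (n * n)) (iter n 1))

theorem runs_reachC {E : List (α × α)} {a : α} (hU : U.length ≤ n) (hE : ArcList U n E)
    (ha : a ∈ U) :
    Runs (reachC E a) (reachCost n) (fun R => AtomSet U R ∧ ∀ b, b ∈ R ↔ Reach E a b) := by
  refine Runs.loop (fun R => AtomSet U R ∧ a ∈ R ∧ ∀ b ∈ R, Reach E a b)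
    (fun R => n - R.length) ⟨AtomSet.nil.cons ha (by simp), by simp, ?_⟩ (Nat.sub_le _ _)
    fun R ⟨hR, haR, hreach⟩ => ?_
  · simp [Reach, Relation.ReflTransGen.refl]
  have hRn := hR.length_le hU
  refine Runs.bind (Runs.filterC (fun e => e.1 ∈ R ∧ e.2 ∉ R) hE.1 fun e he => ?_) fun F hF =>
    Runs.ite (fun h => Runs.pure _ ?_) fun h => ?_
  · refine (runs_memC hRn).bind fun b hb => Runs.ite (fun h => ?_) fun h => ?_
    · refine Runs.bind (t := iter n 1) (t' := 0) (runs_memC hRn) fun b' hb' => Runs.pure _ ?_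
      have := hb.1 h
      simp [← hb', this]
    · exact Runs.pure _ (by simp [mt hb.2 h])
  · refine ⟨hR, fun b => ⟨hreach b, fun hb => ?_⟩⟩
    refine hb.mem_of_closed (Z := {x | x ∈ R}) (fun e he he1 => ?_) haR
    by_contra he2
    have := (hF.2 e).2 ⟨he, he1, he2⟩
    simp_all
  · refine Runs.bind (t' := 0) (Runs.foldC
      (fun pre Q => AtomSet U Q ∧ ∀ b, b ∈ Q ↔ b ∈ R ∨ ∃ e ∈ pre, b = e.2)
      (hF.1.length_le.trans hE.1) ⟨hR, by simp⟩ fun pre Q e he hQ => ?_)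
      fun Q ⟨hQ, hQmem⟩ => Runs.pure _ ⟨⟨hQ, (hQmem a).2 (.inl haR), fun b hb => ?_⟩, ?_⟩
    · refine (runs_insertC hU hQ.1 (hE.2 e (hF.1.subset he)).2).mono le_rfl
        fun Q' hQ' => ⟨hQ'.1, fun b => ?_⟩
      rw [hQ'.2, hQ.2]; simp only [List.mem_append, List.mem_singleton]; grind
    · rcases (hQmem b).1 hb with hb | ⟨e, he, rfl⟩
      · exact hreach b hb
      · obtain ⟨heE, he1, -⟩ := (hF.2 e).1 he
        exact Relation.ReflTransGen.tail (hreach _ he1) heE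
    · obtain ⟨e, he⟩ := List.exists_mem_of_ne_nil F (by simpa using h)
      have h1 := length_lt_of_subset hR.1 (fun b hb => (hQmem b).2 (.inl hb))
        ((hQmem e.2).2 (.inr ⟨e, he, rfl⟩)) ((hF.2 e).1 he).2.2
      have h2 := hQ.length_le hU
      change n - Q.length < n - R.length
      omega

def connectedCost (n : ℕ) : ℕ := iter n (reachCost n + setCost n)

theorem runs_connectedC {E : List (α × α)} {X : List α} (hU : U.length ≤ n) (hE : ArcList U n E)
    (hX : X.length ≤ n) (hXU : X ⊆ U) :
    Runs (connectedC E X) (connectedCost n)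
      (fun r => r = true ↔ ∀ a ∈ X, ∀ b ∈ X, Reach E a b) :=
  Runs.allC _ hX fun _ ha => (runs_reachC hU hE (hXU ha)).bind fun R hR =>
    (runs_subsetC hX (hR.1.length_le hU)).mono le_rfl fun r hr => by simp [hr, hR.2]

/-- `E` are the arcs of the elementary subgraph of `X` for `N`. -/
structure IsElementarySubgraph (N : Theory α) (X : List α) (E : List (α × α)) : Prop where
  arc_mem : ∀ e ∈ E, e.1 ∈ X ∧ e.2 ∈ X
  saturated : ∀ c ∈ N, ∀ h ∈ c.head, h ∈ X →
    (∀ b ∈ c.body, b ∈ X → ∀ b' ∈ c.body, b' ∈ X → Reach E b b') →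
    ∀ b ∈ c.body, b ∈ X → (b, h) ∈ E
  source_mem : ∀ Z : Set α,
    (∀ c ∈ N, (∃ h ∈ c.head, h ∈ X ∧ h ∈ Z) → (∃ b ∈ c.body, b ∈ X ∧ b ∉ Z) →
      ∃ b ∈ c.body, b ∈ X ∧ b ∈ Z) →
    ∀ e ∈ E, e.2 ∈ Z → e.1 ∈ Z

def elementarySubgraphCost (n : ℕ) : ℕ :=
  projCost n + iter n (iter n (connectedCost n) + iter n (iter n (iter n 0)))

/-- Each clause is taken out at most once, so the arcs present plus `n * n` for each remaining
clause never exceed `n * (n * n)`. At the end no remaining clause has a connected body, which gives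
saturation. -/
theorem runs_elementarySubgraphC {N : Theory α} {X : List α} (hU : U.length ≤ n)
    (hN : N.Within U n) (hX : AtomSet U X) :
    Runs (elementarySubgraphC N X) (elementarySubgraphCost n)
      (fun E => ArcList U n E ∧ IsElementarySubgraph N X E) := by
  refine Runs.bind (runs_projC hN (hX.length_le hU)) fun P ⟨hP, hPw⟩ => ?_
  have hPX : ∀ c ∈ P, (∀ h ∈ c.head, h ∈ X) ∧ ∀ b ∈ c.body, b ∈ X := fun c hc => by
    obtain ⟨_, _, hp, _⟩ := hP.1 c hc
    exact ⟨fun h hh => ((hp.1 h).1 hh).2, fun b hb => ((hp.2 b).1 hb).2⟩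
  refine Runs.loop (fun s => s.1.Sublist P ∧ s.2.length + s.1.length * (n * n) ≤ n * (n * n) ∧
    (∀ e ∈ s.2, e.1 ∈ X ∧ e.2 ∈ X) ∧
    (∀ c ∈ P, c ∈ s.1 ∨ ∀ h ∈ c.head, ∀ b ∈ c.body, (b, h) ∈ s.2) ∧
    ∀ Z : Set α, (∀ c ∈ P, (∃ h ∈ c.head, h ∈ Z) → (∃ b ∈ c.body, b ∉ Z) → ∃ b ∈ c.body, b ∈ Z) →
      ∀ e ∈ s.2, e.2 ∈ Z → e.1 ∈ Z)
    (fun s => s.1.length)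
    ⟨.refl _, by simpa using Nat.mul_le_mul_right (n * n) hPw.1, by simp,
      fun c hc => .inl hc, by simp⟩
    hPw.1 ?_
  rintro ⟨T, E⟩ ⟨hT, hlen, hEX, hsat, hsrc⟩
  have hTw := hPw.sublist hT
  have hE : ArcList U n E := ⟨by simp only at hlen; omega, fun e he =>
    ⟨hX.2 (hEX e he).1, hX.2 (hEX e he).2⟩⟩
  refine Runs.bind (Runs.splitC (fun c => ∀ a ∈ c.body, ∀ b ∈ c.body, Reach E a b) hTw.1
    fun c hc => runs_connectedC hU hE (hTw.2 c hc).2 (hTw.2 c hc).4) fun C hC =>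
    Runs.ite (fun h => Runs.pure _ ?_) fun h => ?_
  · refine ⟨hE, hEX, fun c hc h hh hhX hconn b hb hbX => ?_, fun Z hZ => hsrc Z ?_⟩
    · obtain ⟨c', hc', hp⟩ := hP.2 c hc ⟨h, hh, hhX⟩
      rcases hsat c' hc' with hcT | hcE
      · have : c' ∈ C.1 := (hC.4 c').2 ⟨hcT, fun a ha b hb =>
          hconn a ((hp.2 a).1 ha).1 ((hp.2 a).1 ha).2 b ((hp.2 b).1 hb).1 ((hp.2 b).1 hb).2⟩
        simp_all
      · exact hcE h ((hp.1 h).2 ⟨hh, hhX⟩) b ((hp.2 b).2 ⟨hb, hbX⟩)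
    · rintro c hc ⟨h, hh, hhZ⟩ ⟨b, hb, hbZ⟩
      obtain ⟨c', hc', hp, -⟩ := hP.1 c hc
      obtain ⟨b', hb', hbX', hbZ'⟩ := hZ c' hc' ⟨h, ((hp.1 h).1 hh).1, ((hp.1 h).1 hh).2, hhZ⟩
        ⟨b, ((hp.2 b).1 hb).1, ((hp.2 b).1 hb).2, hbZ⟩
      exact ⟨b', (hp.2 b').2 ⟨hb', hbX'⟩, hbZ'⟩
  · have hCpos : 0 < C.1.length := List.length_pos_of_ne_nil (by simpa using h)
    have hCT : ∀ c ∈ C.1, c ∈ P := fun c hc => hT.subset (hC.1.subset hc)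
    have hadd : C.1.length + C.2.length = List.length T := hC.3
    refine Runs.bind (t' := 0) (runs_addArcs (hTw.sublist hC.1)) fun E' ⟨hE'len, hE'⟩ =>
      Runs.pure _ ⟨⟨hC.2.trans hT, ?_, fun e he => ?_, fun c hc => ?_, fun Z hZ e he heZ => ?_⟩, ?_⟩
    · have : List.length T * (n * n) = C.1.length * (n * n) + C.2.length * (n * n) := by
        rw [← add_mul, hadd]
      change E'.length + C.2.length * (n * n) ≤ _
      change E.length + List.length T * (n * n) ≤ _ at hlen
      change E'.length ≤ E.length + _ at hE'len
      omega
    · rcases (hE' e).1 he with he | ⟨c, hc, hb, hh⟩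
      · exact hEX e he
      · exact ⟨(hPX c (hCT c hc)).2 _ hb, (hPX c (hCT c hc)).1 _ hh⟩
    · rcases hsat c hc with hcT | hcE
      · by_cases hcon : ∀ a ∈ c.body, ∀ b ∈ c.body, Reach E a b
        · exact .inr fun h hh b hb =>
            (hE' _).2 (.inr ⟨c, (hC.4 c).2 ⟨hcT, hcon⟩, hb, hh⟩)
        · exact .inl ((hC.5 c).2 ⟨hcT, hcon⟩)
      · exact .inr fun h hh b hb => (hE' _).2 (.inl (hcE h hh b hb))
    · rcases (hE' e).1 he with he | ⟨c, hc, hb, hh⟩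
      · exact hsrc Z hZ e he heZ
      · by_contra hbZ
        obtain ⟨b', hb', hbZ'⟩ := hZ c (hCT c hc) ⟨_, hh, heZ⟩ ⟨_, hb, hbZ⟩
        -- When the clause was taken out, its body atoms reached one another along the old arcs. One
        -- of them lies in `Z`, which is closed under predecessors along those arcs, so all do.
        exact hbZ ((((hC.4 c).1 hc).2 _ hb _ hb').mem_of_mem (hsrc Z hZ) hbZ')
    · change C.2.length < List.length T
      omega

/-- `C` is the strongly connected component of `a`. -/
abbrev IsComponent (E : List (α × α)) (X : List α) (a : α) (C : List α) : Prop :=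
  IsFilter (fun b => Reach E a b ∧ Reach E b a) X C

def componentCost (n : ℕ) : ℕ := reachCost n + iter n (iter n 1 + (reachCost n + iter n 1))

theorem runs_componentC {E : List (α × α)} {X : List α} {a : α} (hU : U.length ≤ n)
    (hE : ArcList U n E) (hX : AtomSet U X) (ha : a ∈ U) :
    Runs (componentC E X a) (componentCost n) (IsComponent E X a) := by
  refine (runs_reachC hU hE ha).bind fun R hR => Runs.filterC _ (hX.length_le hU) fun b hb => ?_
  refine (runs_memC (hR.1.length_le hU)).bind fun r hr => Runs.ite (fun h => ?_) fun h => ?_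
  · refine (runs_reachC hU hE (hX.2 hb)).bind fun R' hR' => ?_
    refine (runs_memC (hR'.1.length_le hU)).mono le_rfl fun r' hr' => ?_
    rw [hr', hR'.2, ← hR.2 b]
    simp [hr.1 h]
  · exact Runs.pure _ (by simp [← hR.2 b, mt hr.2 h])

def lastLevelCost (n : ℕ) : ℕ :=
  iter n (reachCost n + (componentCost n + setCost n)) + iter n (componentCost n)

theorem runs_lastLevelC {E : List (α × α)} {X : List α} (hU : U.length ≤ n)
    (hE : ArcList U n E) (hX : AtomSet U X) :
    Runs (lastLevelC E X) (lastLevelCost n) (fun L => L.length ≤ n ∧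
      (∀ C ∈ L, ∃ a ∈ X, IsTerminal E X a ∧ IsComponent E X a C) ∧
      ((∃ a ∈ X, IsTerminal E X a) → L ≠ [])) := by
  have hXn := hX.length_le hU
  refine Runs.bind (Runs.filterC (IsTerminal E X) hXn fun a ha => ?_) fun Y hY => ?_
  · refine (runs_reachC hU hE (hX.2 ha)).bind fun R hR => ?_
    refine (runs_componentC hU hE hX (hX.2 ha)).bind fun C hC => ?_
    refine (runs_subsetC (hR.1.length_le hU) (hC.1.length_le.trans hXn)).mono le_rfl fun r hr => ?_
    rw [hr]
    simp only [hR.2, hC.2, IsTerminal]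
    exact forall₂_congr fun b hb => by simp [hb]
  · refine (Runs.mapC (IsComponent E X) (hY.1.length_le.trans hXn)
      fun a ha => runs_componentC hU hE hX (hX.2 (hY.1.subset ha))).mono le_rfl
      fun L hL => ⟨hL.1.trans_le (hY.1.length_le.trans hXn), fun C hC => ?_, ?_⟩
    · obtain ⟨a, ha, h⟩ := hL.2 C hC
      exact ⟨a, ((hY.2 a).1 ha).1, ((hY.2 a).1 ha).2, h⟩
    · rintro ⟨a, ha, hterm⟩
      obtain ⟨C, hC, -⟩ := hL.3 a ((hY.2 a).2 ⟨ha, hterm⟩)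
      exact List.ne_nil_of_mem hC

/-! ## Super-elementary sets -/

/-- A non-empty set `X` of atoms of `Q`, elementary for the Horn clauses of `Q`, that meets the body
of each Horn clause whose head it meets. -/
structure IsSuperElementary (Q : Theory α) (X : List α) : Prop where
  ne_nil : X ≠ []
  mem_atoms : ∀ a ∈ X, a ∈ Q.atoms
  body_meets : ∀ c ∈ Q, c.IsHorn → (∃ h ∈ c.head, h ∈ X) → ∃ b ∈ c.body, b ∈ X
  outbound : ∀ Z : Set α, (∃ a ∈ X, a ∈ Z) → (∃ a ∈ X, a ∉ Z) → ∃ c ∈ Q, c.IsHorn ∧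
    (∃ h ∈ c.head, h ∈ X ∧ h ∈ Z) ∧ (∃ b ∈ c.body, b ∈ X ∧ b ∉ Z) ∧ ∀ b ∈ c.body, b ∈ X → b ∉ Z

def findCost (n : ℕ) : ℕ :=
  iter n (setCost n + setCost n) + (iter n (iter n 1) + iter n (elementarySubgraphCost n +
    (connectedCost n + (lastLevelCost n + (iter n 0 + setCost n)))))

/-- The loop invariant is non-emptiness together with the body condition; outboundness is obtained
only on exit, from strong connectivity. -/
theorem runs_findSuperElementarySet (sel : Selection α) {Q : Theory α} (hU : U.length ≤ n)
    (hQ : Q.Within U n) (hne : Q.atoms.Nonempty)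
    (hbody : ∀ c ∈ Q, c.IsHorn → c.head ≠ [] → c.body ≠ []) :
    Runs (findSuperElementarySet sel Q) (findCost n)
      (fun X => AtomSet U X ∧ IsSuperElementary Q X) := by
  refine Runs.bind (runs_atomsC hU hQ) fun X₀ ⟨hX₀, hX₀mem⟩ => ?_
  refine Runs.bind (runs_ndC hQ) fun N hN => ?_
  have hNw := hQ.sublist hN.1
  refine Runs.loop (fun X => AtomSet U X ∧ X ≠ [] ∧ (∀ a ∈ X, a ∈ Q.atoms) ∧
    ∀ c ∈ N, (∃ h ∈ c.head, h ∈ X) → ∃ b ∈ c.body, b ∈ X) List.length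
    ⟨hX₀, ?_, fun a ha => (hX₀mem a).1 ha, ?_⟩ (hX₀.length_le hU) fun X ⟨hX, hXne, hXQ, hmeets⟩ => ?_
  · obtain ⟨a, ha⟩ := hne
    exact List.ne_nil_of_mem ((hX₀mem a).2 ha)
  · rintro c hc ⟨h, hh, -⟩
    obtain ⟨hcQ, hhorn⟩ := (hN.2 c).1 hc
    obtain ⟨b, hb⟩ := List.exists_mem_of_ne_nil _ (hbody c hcQ hhorn (List.ne_nil_of_mem hh))
    exact ⟨b, hb, (hX₀mem b).2 ⟨c, hcQ, .inr hb⟩⟩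
  have hXn := hX.length_le hU
  refine (runs_elementarySubgraphC hU hNw hX).bind fun E ⟨hE, hEX⟩ => ?_
  refine (runs_connectedC hU hE hXn hX.2).bind fun r hr => Runs.ite (fun h => Runs.pure _ ?_)
    fun h => (runs_lastLevelC hU hE hX).bind fun L ⟨hLn, hL, hLne⟩ => ?_
  · refine ⟨hX, hXne, hXQ, fun c hc hhorn => hmeets c ((hN.2 c).2 ⟨hc, hhorn⟩), ?_⟩
    rintro Z ⟨a, ha, haZ⟩ ⟨b, hb, hbZ⟩
    by_contra! hcon
    -- If no clause witnesses outboundness, `Z` is closed under predecessors; as `b` reaches `a ∈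
    -- Z`, this contradicts `b ∉ Z`.
    refine hbZ ((hr.1 h b hb a ha).mem_of_mem (hEX.source_mem Z fun c hc hhead hbod => ?_) haZ)
    obtain ⟨hcQ, hhorn⟩ := (hN.2 c).1 hc
    exact hcon c hcQ hhorn hhead hbod
  · cases L with
    | nil => exact absurd rfl (hLne (exists_isTerminal hEX.arc_mem hXne))
    | cons C₀ L =>
      refine Runs.bind (Runs.pick (by simp at hLn; omega)) fun C hC => ?_
      obtain ⟨a, ha, hterm, hcomp⟩ := hL C hC
      refine Runs.bind (t' := 0) (runs_diffC hXn (hcomp.1.length_le.trans hXn)) fun X' hX' =>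
        Runs.pure _ ⟨⟨hX.sublist hX'.1, ?_, fun x hx => hXQ x (hX'.1.subset hx), ?_⟩, ?_⟩
      · rintro rfl
        -- If nothing were left, `X` would be a single component and the connectivity test would
        -- have succeeded.
        have hall : ∀ x ∈ X, x ∈ C := fun x hx => by
          by_contra hxC
          simpa using (hX'.2 x).2 ⟨hx, hxC⟩
        exact h (hr.2 fun x hx y hy => Relation.ReflTransGen.trans
          ((hcomp.2 x).1 (hall x hx)).2.2 ((hcomp.2 y).1 (hall y hy)).2.1)
      · rintro c hc ⟨h, hh, hhX'⟩
        obtain ⟨hhX, hhC⟩ := (hX'.2 h).1 hhX'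
        obtain ⟨b, hb, hbX⟩ := hmeets c hc ⟨h, hh, hhX⟩
        by_contra! hcon
        have hC' : ∀ x ∈ c.body, x ∈ X → x ∈ C := fun x hx hxX => by
          by_contra hxC
          exact hcon x hx ((hX'.2 x).2 ⟨hxX, hxC⟩)
        -- All body atoms in `X` lie in the component `C`, so saturation yields an arc from `C` to
        -- `h`; as `C` has no outgoing arcs, `h` lies in `C`.
        have hbh : (b, h) ∈ E := hEX.saturated c hc h hh hhX (fun x hx hxX y hy hyX =>
          Relation.ReflTransGen.trans ((hcomp.2 x).1 (hC' x hx hxX)).2.2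
            ((hcomp.2 y).1 (hC' y hy hyX)).2.1) b hb hbX
        have hah : Reach E a h := Relation.ReflTransGen.tail ((hcomp.2 b).1 (hC' b hb hbX)).2.1 hbh
        exact hhC ((hcomp.2 h).2 ⟨hhX, hah, (hterm h hah).2⟩)
      · have haC : a ∈ C := (hcomp.2 a).2
          ⟨ha, Relation.ReflTransGen.refl, Relation.ReflTransGen.refl⟩
        exact length_lt_of_subset (hX.sublist hX'.1).1 hX'.1.subset ha
          fun h => ((hX'.2 a).1 h).2 haC

end Graphs

section Algorithm

variable {α : Type} {U : List α} {n : ℕ} {T Q : Theory α} {M S X : List α}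

/-! ## Eliminable sets of atoms -/

theorem IsSimplified.mem_of_mem_atoms (hQ : IsSimplified T M S Q) {a : α} (ha : a ∈ Q.atoms) :
    a ∈ M ∧ a ∉ S ∧ a ∈ T.atoms := by
  obtain ⟨q, hq, h⟩ := ha
  obtain ⟨c, hc, -, -, hp, -⟩ := hQ.exists_source q hq
  rcases h with h | h
  · have := (hp.1 a).1 h
    exact ⟨this.2.1, this.2.2, c, hc, .inl this.1⟩
  · have := (hp.2 a).1 h
    exact ⟨this.2.1, this.2.2, c, hc, .inr this.1⟩

/-- An empty projected body means that the original body lies in `S`. As the head has only one atom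
in `M`, unit propagation would have put that atom into `S`. -/
theorem IsSimplified.body_ne_nil (hQ : IsSimplified T M S Q) (hS : IsSteady T M S) {q : Clause α}
    (hq : q ∈ Q) (hhorn : q.IsHorn) : q.body ≠ [] := by
  intro hbody
  obtain ⟨c, hc, hhead, hbM, hp, hne⟩ := hQ.exists_source q hq
  obtain ⟨h, hh⟩ := List.exists_mem_of_ne_nil _ hne
  have hh' := (hp.1 h).1 hh
  refine hh'.2.2 (hS.closed c hc h hh'.1 hh'.2.1 (fun h' hh1 hM => ?_) fun b hb => ?_)
  · exact hhorn h' ((hp.1 h').2 ⟨hh1, hM, hhead h' hh1⟩) h hh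
  · by_contra hbS
    have := (hp.2 b).2 ⟨hb, hbM b hb, hbS⟩
    simp [hbody] at this

/-- A set of atoms outside the steady set can be removed from a model if no clause of the simplified
theory becomes false. -/
theorem IsSimplified.holds_diff (hQ : IsSimplified T M S Q) (hS : IsSteady T M S)
    (hM : T.Holds {a | a ∈ M}) {D : Set α} (hDS : ∀ a ∈ D, a ∉ S)
    (hD : ∀ q ∈ Q, (∀ b ∈ q.body, b ∉ D) → ∃ h ∈ q.head, h ∉ D) :
    T.Holds {a | a ∈ M ∧ a ∉ D} := by
  intro c hc
  by_cases hbody : ∀ b ∈ c.body, b ∈ M ∧ b ∉ D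
  · left
    by_cases hhead : ∀ h ∈ c.head, h ∉ S
    · rcases hM c hc with ⟨h, hh, hhM⟩ | ⟨b, hb, hbM⟩
      · obtain ⟨q, hq, hp⟩ := hQ.exists_target c hc hhead (fun b hb => (hbody b hb).1) ⟨h, hh, hhM⟩
        obtain ⟨h', hh', hD'⟩ := hD q hq fun b hb => (hbody b ((hp.2 b).1 hb).1).2
        have := (hp.1 h').1 hh'
        exact ⟨h', this.1, this.2.1, hD'⟩
      · exact absurd (hbody b hb).1 hbM
    · push Not at hhead
      obtain ⟨h, hh, hhS⟩ := hhead
      exact ⟨h, hh, hS.subset h hhS, fun hhD => hDS h hhD hhS⟩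
  · push Not at hbody
    obtain ⟨b, hb, hbD⟩ := hbody
    exact .inr ⟨b, hb, fun h => h.2 (hbD h.1)⟩

theorem IsSimplified.holds_diff_of_isHorn (hQ : IsSimplified T M S Q) (hS : IsSteady T M S)
    (hM : T.Holds {a | a ∈ M}) (hhorn : ∀ q ∈ Q, q.IsHorn) {D : Set α}
    (hD : ∀ a, a ∈ D ↔ a ∈ M ∧ a ∉ S) : T.Holds {a | a ∈ M ∧ a ∉ D} := by
  refine hQ.holds_diff hS hM (fun a ha => ((hD a).1 ha).2) fun q hq hbody => ?_
  obtain ⟨b, hb⟩ := List.exists_mem_of_ne_nil _ (hQ.body_ne_nil hS hq (hhorn q hq))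
  exact absurd ((hD b).2 (hQ.mem_of_mem_atoms ⟨q, hq, .inr hb⟩ |>.imp_right And.left)) (hbody b hb)

/-- Since `X` lies in `M \ S`, projection loses no atoms of `X`, so the source of a witnessing
clause is again a witness. Its head has no further atom in `X` because the projected clause is Horn.
-/
theorem IsSuperElementary.elementary (hX : IsSuperElementary Q X) (hQ : IsSimplified T M S Q) :
    T.Elementary {a | a ∈ X} := by
  have hXM := fun a ha => hQ.mem_of_mem_atoms (hX.mem_atoms a ha)
  refine ⟨List.exists_mem_of_ne_nil _ hX.ne_nil, fun a ha => (hXM a ha).2.2, fun Z hZX hZ => ?_⟩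
  obtain ⟨a, haX, haZ⟩ := Set.exists_of_ssubset hZX
  obtain ⟨z, hz⟩ := hZ
  obtain ⟨q, hq, hhorn, ⟨h, hh, -, hhZ⟩, ⟨b, hb, hbX, hbZ⟩, hbody⟩ :=
    hX.outbound Z ⟨z, hZX.1 hz, hz⟩ ⟨a, haX, haZ⟩
  obtain ⟨c, hc, -, -, hp, -⟩ := hQ.exists_source q hq
  have hproj : ∀ x ∈ X, x ∈ {a | a ∈ M ∧ a ∉ S} := fun x hx => ⟨(hXM x hx).1, (hXM x hx).2.1⟩
  refine ⟨hZX.1, c, hc, ⟨h, ((hp.1 h).1 hh).1, hhZ⟩, ⟨b, ((hp.2 b).1 hb).1, hbX, hbZ⟩, ?_, ?_⟩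
  · refine Set.eq_empty_of_forall_notMem fun x ⟨hxB, hxZ⟩ => ?_
    exact hbody x ((hp.2 x).2 ⟨hxB, hproj x (hZX.1 hxZ)⟩) (hZX.1 hxZ) hxZ
  · refine Set.eq_empty_of_forall_notMem fun x ⟨hxH, hxX, hxZ⟩ => ?_
    exact hxZ (hhorn h hh x ((hp.1 x).2 ⟨hxH, hproj x hxX⟩) ▸ hhZ)

/-- The only use of HEF: two distinct atoms in a projected head inside `X` would be two atoms of an
elementary set in one head of `T`. -/
theorem IsSuperElementary.holds_diff (hX : IsSuperElementary Q X) (hT : T.IsHEF)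
    (hQ : IsSimplified T M S Q) (hS : IsSteady T M S) (hM : T.Holds {a | a ∈ M}) :
    T.Holds {a | a ∈ M ∧ a ∉ X} := by
  refine hQ.holds_diff hS hM (D := {a | a ∈ X})
    (fun a ha => (hQ.mem_of_mem_atoms (hX.mem_atoms a ha)).2.1) fun q hq hbody => ?_
  by_contra! hhead
  obtain ⟨c, hc, -, -, hp, hne⟩ := hQ.exists_source q hq
  have hhorn : q.IsHorn := by
    intro a ha b hb
    by_contra hab
    exact hT c hc ⟨_, hX.elementary hQ, Set.one_lt_encard_iff.2
      ⟨a, b, ⟨hhead a ha, ((hp.1 a).1 ha).1⟩, ⟨hhead b hb, ((hp.1 b).1 hb).1⟩, hab⟩⟩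
  obtain ⟨h, hh⟩ := List.exists_mem_of_ne_nil _ hne
  obtain ⟨b, hb, hbX⟩ := hX.body_meets q hq hhorn ⟨h, hh, hhead h hh⟩
  exact hbody b hb hbX

theorem isMinimalModel_of_least {T : Theory α} (hUT : ∀ a ∈ U, a ∈ T.atoms) (hM : AtomSet U M)
    (hholds : T.Holds {a | a ∈ M})
    (hleast : ∀ I : Set α, I ⊆ {a | a ∈ M} → T.Holds I → ∀ a ∈ M, a ∈ I) :
    T.IsMinimalModel {a | a ∈ M} :=
  ⟨⟨fun a ha => hUT a (hM.2 ha), hholds⟩, fun J hJ hJT => hJ.2 (hleast J hJ.1 hJT.2)⟩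

/-! ## The operator -/

variable [DecidableEq α]

def deltaCost (n : ℕ) : ℕ :=
  setCost n + (iter n (setCost n + setCost n) + (iter n (iter n 1) +
    (iter n (setCost n + setCost n) + ((setCost n + setCost n) + ((setCost n + setCost n) +
      (setCost n + iter n 0))))))

/-- The last condition makes `Δ` removable without HEF. Atoms outside `Q` occur in no head of `Q`; a
single atom outside the Horn part cannot be the whole head of a clause, which would then be Horn.
The outcomes of the two tests are irrelevant to this. -/
theorem runs_deltaC (sel : Selection α) (hU : U.length ≤ n) (hQ : Q.Within U n)
    (hhead : ∀ q ∈ Q, q.head ≠ []) (hM : AtomSet U M) (hS : AtomSet U S) :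
    Runs (deltaC sel T M S Q) (deltaCost n) (fun Δ => AtomSet U Δ ∧ (∀ a ∈ Δ, a ∈ M ∧ a ∉ S) ∧
      ∀ q ∈ Q, ∃ h ∈ q.head, h ∉ Δ) := by
  have hMn := hM.length_le hU
  refine (runs_diffC hMn (hS.length_le hU)).bind fun R hR => ?_
  have hRn := hR.1.length_le.trans hMn
  refine (runs_atomsC hU hQ).bind fun A hA => ?_
  refine (runs_ndC hQ).bind fun N hN => ?_
  refine (runs_atomsC hU (hQ.sublist hN.1)).bind fun A' hA' => ?_
  have hAn := hA.1.length_le hU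
  have hAn' := hA'.1.length_le hU
  refine (runs_ssupsetC hRn hAn).bind fun r _ => Runs.ite (fun _ => ?_) fun _ => ?_
  · refine (runs_diffC hRn hAn).mono (by omega) fun Δ hΔ =>
      ⟨(hM.sublist hR.1).sublist hΔ.1, fun a ha => (hR.2 a).1 (hΔ.1.subset ha), fun q hq => ?_⟩
    obtain ⟨h, hh⟩ := List.exists_mem_of_ne_nil _ (hhead q hq)
    exact ⟨h, hh, fun hhΔ => ((hΔ.2 h).1 hhΔ).2 ((hA.2 h).2 ⟨q, hq, .inl hh⟩)⟩
  have hnil : AtomSet U [] ∧ (∀ a ∈ ([] : List α), a ∈ M ∧ a ∉ S) ∧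
      ∀ q ∈ Q, ∃ h ∈ q.head, h ∉ ([] : List α) :=
    ⟨.nil, by simp, fun q hq => by simpa using List.exists_mem_of_ne_nil _ (hhead q hq)⟩
  refine (runs_ssupsetC hRn hAn').bind fun r _ => Runs.ite (fun _ => ?_) fun _ => Runs.pure _ hnil
  refine (runs_diffC hRn hAn').bind fun D hD => ?_
  cases D with
  | nil => exact Runs.pure _ hnil
  | cons a D =>
    have hDn := hD.1.length_le.trans hRn
    refine Runs.bind (t' := 0) (Runs.pick (by simp at hDn; omega)) fun x hx => Runs.pure _ ?_
    obtain ⟨hxR, hxA⟩ := (hD.2 x).1 hx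
    have hxM := (hR.2 x).1 hxR
    refine ⟨AtomSet.nil.cons (hM.2 hxM.1) (by simp), by simpa using hxM, fun q hq => ?_⟩
    by_contra! hcon
    have hq' : ∀ h ∈ q.head, h = x := fun h hh => by simpa using hcon h hh
    obtain ⟨h, hh⟩ := List.exists_mem_of_ne_nil _ (hhead q hq)
    exact hxA ((hA'.2 x).2 ⟨q, (hN.2 q).2 ⟨hq, fun a ha b hb => by rw [hq' a ha, hq' b hb]⟩,
      .inl (hq' h hh ▸ hh)⟩)

def xiCost (n : ℕ) : ℕ :=
  iter n (setCost n + (steadyCost n + (simplifiedCost n + (deltaCost n + setCost n)))) +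
    ((iter n (iter n 1) + (setCost n + findCost n)) + setCost n)

/-- The `Δ` phase preserves the clauses unconditionally; only the final set may need HEF. An empty
result means that nothing was removed and that the Horn branch was taken with `M \ S` empty, since
the other branch returns a non-empty set. -/
theorem runs_xiHEF (sel : Selection α) (hU : U.length ≤ n) (hT : T.Within U n)
    (hM : AtomSet U M) (hholds : T.Holds {a | a ∈ M}) :
    Runs (xiHEF sel T M) (xiCost n) (fun E => AtomSet U E ∧ (∀ a ∈ E, a ∈ M) ∧
      (E = [] → ∀ I : Set α, I ⊆ {a | a ∈ M} → T.Holds I → ∀ a ∈ M, a ∈ I) ∧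
      (T.IsHEF → T.Holds {a | a ∈ M ∧ a ∉ E})) := by
  refine Runs.bind (P := fun r => AtomSet U r.1 ∧ AtomSet U r.2.1 ∧ AtomSet U r.2.2.2 ∧
      (∀ a ∈ r.2.2.2, a ∈ M) ∧ (∀ a, a ∈ r.1 ↔ a ∈ M ∧ a ∉ r.2.2.2) ∧ T.Holds {a | a ∈ r.1} ∧
      IsSteady T r.1 r.2.1 ∧ IsSimplified T r.1 r.2.1 r.2.2.1 ∧ Theory.Within U n r.2.2.1) ?_ ?_
  -- At the head of the loop the latest `Δ` is recorded in `s.2` but not yet removed from `s.1`, so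
  -- the invariant concerns their difference.
  · refine Runs.loop (fun s => AtomSet U s.1 ∧ AtomSet U s.2 ∧ (∀ a ∈ s.2, a ∈ M) ∧
      (∀ a, a ∈ s.1 ∧ a ∉ s.2 ↔ a ∈ M ∧ a ∉ s.2) ∧ T.Holds {a | a ∈ s.1 ∧ a ∉ s.2})
      (fun s => n - s.2.length) ⟨hM, .nil, by simp, by simp, by simpa using hholds⟩
      (Nat.sub_le _ _) ?_
    rintro ⟨M₀, E⟩ ⟨hM₀, hE, hEM, hmem, hholds⟩
    refine (runs_diffC (hM₀.length_le hU) (hE.length_le hU)).bind fun M₁ hM₁ => ?_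
    have hM₁s := hM₀.sublist hM₁.1
    have hset : {a | a ∈ M₁} = {a | a ∈ M₀ ∧ a ∉ E} := Set.ext hM₁.2
    have hM₁M : ∀ a, a ∈ M₁ ↔ a ∈ M ∧ a ∉ E := fun a => (hM₁.2 a).trans (hmem a)
    have hholds₁ : T.Holds {a | a ∈ M₁} := hset ▸ hholds
    refine (runs_steadyC hU hT (hM₁s.length_le hU)).bind fun S ⟨hS, hsteady⟩ => ?_
    refine (runs_simplifiedC hT (hM₁s.length_le hU) (hS.length_le hU)).bind fun Q ⟨hQ, hQw⟩ => ?_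
    refine (runs_deltaC sel hU hQw (fun q hq => ?_) hM₁s hS).bind fun Δ ⟨hΔ, hΔM, hΔQ⟩ => ?_
    · obtain ⟨_, _, _, _, _, h⟩ := hQ.exists_source q hq
      exact h
    refine Runs.bind (t' := 0) (runs_unionC hU hE hΔ.2 (hΔ.length_le hU)) fun E₁ ⟨hE₁, hE₁mem⟩ =>
      Runs.ite (fun h => Runs.pure _ ?_) fun h => Runs.pure _ ⟨⟨hM₁s, hE₁, ?_, ?_, ?_⟩, ?_⟩
    · obtain rfl : Δ = [] := by simpa using h
      have hEE : ∀ a, a ∈ E₁ ↔ a ∈ E := by simpa using hE₁mem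
      exact ⟨hM₁s, hS, hE₁, fun a ha => hEM a ((hEE a).1 ha), fun a => by rw [hM₁M, hEE], hholds₁,
        hsteady, hQ, hQw⟩
    · intro a ha
      rcases (hE₁mem a).1 ha with ha | ha
      · exact hEM a ha
      · exact ((hM₁M a).1 (hΔM a ha).1).1
    · intro a
      rw [hM₁M, hE₁mem]; tauto
    · have := hQ.holds_diff hsteady hholds₁ (D := {a | a ∈ Δ}) (fun a ha => (hΔM a ha).2)
        fun q hq _ => hΔQ q hq
      convert this using 3 with a
      have h1 := hM₁M a
      have h2 := hE₁mem a
      simp only [Set.mem_ofPred_eq]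
      tauto
    · obtain ⟨a, ha⟩ := List.exists_mem_of_ne_nil Δ (by simpa using h)
      have h1 : E.length < E₁.length := length_lt_of_subset hE.1 (fun b hb => (hE₁mem b).2 (.inl hb))
        ((hE₁mem a).2 (.inr ha)) ((hM₁M a).1 (hΔM a ha).1).2
      have h2 := hE₁.length_le hU
      change n - E₁.length < n - E.length
      omega
  · rintro ⟨M₁, S, Q, E⟩ ⟨hM₁, hS, hE, hEM, hmem, hholds₁, hsteady, hQ, hQw⟩
    simp only at hM₁ hS hE hEM hmem hholds₁ hsteady hQ hQw
    refine Runs.bind (P := fun D => AtomSet U D ∧ (∀ a ∈ D, a ∈ M₁ ∧ a ∉ S) ∧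
      (D = [] → ∀ a ∈ M₁, a ∈ S) ∧ (T.IsHEF → T.Holds {a | a ∈ M₁ ∧ a ∉ D})) ?_ ?_
    · refine Runs.bind (Runs.allC Clause.IsHorn hQw.1 fun q hq => runs_isHornC (hQw.2 q hq))
        fun r hr => Runs.ite (fun h => ?_) fun h => ?_
      · refine (runs_diffC (hM₁.length_le hU) (hS.length_le hU)).mono (by omega) fun D hD =>
          ⟨hM₁.sublist hD.1, fun a ha => (hD.2 a).1 ha, ?_, fun _ =>
            hQ.holds_diff_of_isHorn hsteady hholds₁ (hr.1 h) (D := {a | a ∈ D}) hD.2⟩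
        rintro rfl a ha
        by_contra haS
        simpa using (hD.2 a).2 ⟨ha, haS⟩
      · refine (runs_findSuperElementarySet sel hU hQw ?_ fun q hq hhorn _ =>
          hQ.body_ne_nil hsteady hq hhorn).mono (by omega) fun X ⟨hX, hXs⟩ =>
          ⟨hX, fun a ha => ?_, fun hnil => absurd hnil hXs.ne_nil,
            fun hHEF => hXs.holds_diff hHEF hQ hsteady hholds₁⟩
        · have := mt hr.2 h
          push Not at this
          obtain ⟨q, hq, -⟩ := this
          obtain ⟨_, _, _, _, _, hne⟩ := hQ.exists_source q hq
          obtain ⟨a, ha⟩ := List.exists_mem_of_ne_nil _ hne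
          exact ⟨a, q, hq, .inl ha⟩
        · exact (hQ.mem_of_mem_atoms (hXs.mem_atoms a ha)).imp_right And.left
    · rintro D ⟨hD, hDM, hDnil, hDholds⟩
      refine (runs_unionC hU hE hD.2 (hD.length_le hU)).mono le_rfl fun E₁ ⟨hE₁, hE₁mem⟩ =>
        ⟨hE₁, fun a ha => ?_, ?_, fun hHEF => ?_⟩
      · rcases (hE₁mem a).1 ha with ha | ha
        · exact hEM a ha
        · exact ((hmem a).1 (hDM a ha).1).1
      · rintro rfl I hIM hI a ha
        have hE0 : ∀ b, b ∉ E := fun b hb => by simpa using (hE₁mem b).2 (.inl hb)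
        have hD0 : D = [] := List.eq_nil_iff_forall_not_mem.2 fun b hb => by
          simpa using (hE₁mem b).2 (.inr hb)
        exact hsteady.least I (fun b hb => (hmem b).2 ⟨hIM hb, hE0 b⟩) hI a
          (hDnil hD0 a ((hmem a).2 ⟨ha, hE0 a⟩))
      · convert hDholds hHEF using 3 with a
        rw [hE₁mem, hmem]; tauto

/-! ## The generalized elimination algorithm -/

def igeaCost (n : ℕ) : ℕ :=
  iter n (setCost n) + iter n (steadyCost n + (iter n (setCost n + setCost n) + (xiCost n +
    (setCost n + iter n (setCost n + setCost n)))))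

/-- Positivity makes the set of all head atoms satisfy every clause, which starts the invariant; the
non-empty `E ⊆ M` shortens `M` in each round. Failure contradicts HEF because `M \ E` is then a
model. -/
theorem runs_igea (sel : Selection α) (hU : U.length ≤ n) (hT : T.Within U n)
    (hUT : ∀ a ∈ U, a ∈ T.atoms) (hpos : T.Positive) :
    Runs (igea (xiHEF sel) T) (igeaCost n) (fun r =>
      (r.1 = Verdict.success ∧ T.IsMinimalModel {a | a ∈ r.2}) ∨
      (r.1 = Verdict.failure ∧ T.IsModel {a | a ∈ r.2} ∧ ¬T.IsHEF)) := by
  refine (runs_headsC hU hT).bind fun M₀ ⟨hM₀, hM₀mem⟩ => ?_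
  refine Runs.loop (fun M => AtomSet U M ∧ T.Holds {a | a ∈ M}) List.length ⟨hM₀, fun c hc => ?_⟩
    (hM₀.length_le hU) fun M ⟨hM, hholds⟩ => ?_
  · obtain ⟨h, hh⟩ := hpos c hc
    exact .inl ⟨h, hh, (hM₀mem h).2 ⟨c, hc, hh⟩⟩
  have hMn := hM.length_le hU
  refine (runs_steadyC hU hT hMn).bind fun S ⟨hS, hsteady⟩ => ?_
  refine (runs_isModelC hT (hS.length_le hU)).bind fun r hr =>
    Runs.ite (fun h => Runs.pure _ (.inl ⟨rfl, ?_⟩)) fun _ => ?_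
  · exact isMinimalModel_of_least hUT hS (hr.1 h) fun I hIS hI =>
      hsteady.least I (fun a ha => hsteady.subset a (hIS ha)) hI
  refine (runs_xiHEF sel hU hT hM hholds).bind fun E ⟨hE, hEM, hEnil, hEholds⟩ =>
    Runs.ite (fun h => Runs.pure _ (.inl ⟨rfl, ?_⟩)) fun hne => ?_
  · exact isMinimalModel_of_least hUT hM hholds (hEnil (by simpa using h))
  refine (runs_diffC hMn (hE.length_le hU)).bind fun M' hM' => ?_
  have hM's := hM.sublist hM'.1
  refine Runs.bind (t' := 0) (runs_isModelC hT (hM's.length_le hU)) fun r hr =>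
    Runs.ite (fun h => Runs.pure _ ⟨⟨hM's, hr.1 h⟩, ?_⟩) fun h => Runs.pure _ (.inr ⟨rfl, ?_, ?_⟩)
  · obtain ⟨a, ha⟩ := List.exists_mem_of_ne_nil E (by simpa using hne)
    exact length_lt_of_subset hM's.1 hM'.1.subset (hEM a ha) fun h' => ((hM'.2 a).1 h').2 ha
  · exact ⟨fun a ha => hUT a (hM.2 ha), hholds⟩
  · intro hHEF
    have hset : {a | a ∈ M'} = {a | a ∈ M ∧ a ∉ E} := Set.ext hM'.2
    exact h (hr.2 (hset ▸ hEholds hHEF))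

end Algorithm

/-! ## Polynomial bounds -/

/-- The function `f` is given by a polynomial. -/
def IsPoly (f : ℕ → ℕ) : Prop := ∃ p : Polynomial ℕ, ∀ n, p.eval n = f n

namespace IsPoly

theorem id : IsPoly fun n => n := ⟨.X, by simp⟩

theorem const (k : ℕ) : IsPoly fun _ => k := ⟨.C k, by simp⟩

theorem add {f g : ℕ → ℕ} (hf : IsPoly f) (hg : IsPoly g) : IsPoly fun n => f n + g n := by
  obtain ⟨p, hp⟩ := hf
  obtain ⟨q, hq⟩ := hg
  exact ⟨p + q, by simp [hp, hq]⟩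

theorem mul {f g : ℕ → ℕ} (hf : IsPoly f) (hg : IsPoly g) : IsPoly fun n => f n * g n := by
  obtain ⟨p, hp⟩ := hf
  obtain ⟨q, hq⟩ := hg
  exact ⟨p * q, by simp [hp, hq]⟩

theorem iter {f g : ℕ → ℕ} (hf : IsPoly f) (hg : IsPoly g) : IsPoly fun n => iter (f n) (g n) :=
  (hf.add (const 1)).mul (hg.add (const 1))

theorem setCost : IsPoly setCost := id.iter (id.iter (const 1))

theorem setCost₂ : IsPoly fun n => CNF.setCost n + CNF.setCost n := setCost.add setCost

theorem projCost : IsPoly projCost := (id.iter setCost₂).add (id.iter (const 1))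

theorem leastModelCost : IsPoly leastModelCost :=
  id.iter ((id.iter setCost₂).add ((id.iter setCost).add setCost))

theorem steadyCost : IsPoly steadyCost :=
  projCost.add ((id.iter (id.iter (const 1))).add leastModelCost)

theorem simplifiedCost : IsPoly simplifiedCost := (id.iter setCost₂).add (setCost.add projCost)

theorem reachCost : IsPoly reachCost :=
  have h : IsPoly fun n => n * (n * n) := id.mul (id.mul id)
  id.iter ((h.iter ((id.iter (const 1)).add (id.iter (const 1)))).add (h.iter (id.iter (const 1))))

theorem connectedCost : IsPoly connectedCost := id.iter (reachCost.add setCost)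

theorem elementarySubgraphCost : IsPoly elementarySubgraphCost :=
  projCost.add (id.iter ((id.iter connectedCost).add (id.iter (id.iter (id.iter (const 0))))))

theorem componentCost : IsPoly componentCost :=
  reachCost.add (id.iter ((id.iter (const 1)).add (reachCost.add (id.iter (const 1)))))

theorem lastLevelCost : IsPoly lastLevelCost :=
  (id.iter (reachCost.add (componentCost.add setCost))).add (id.iter componentCost)

theorem findCost : IsPoly findCost :=
  (id.iter setCost₂).add ((id.iter (id.iter (const 1))).add (id.iter (elementarySubgraphCost.add
    (connectedCost.add (lastLevelCost.add ((id.iter (const 0)).add setCost))))))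

theorem deltaCost : IsPoly deltaCost :=
  setCost.add ((id.iter setCost₂).add ((id.iter (id.iter (const 1))).add
    ((id.iter setCost₂).add (setCost₂.add (setCost₂.add (setCost.add (id.iter (const 0))))))))

theorem xiCost : IsPoly xiCost :=
  (id.iter (setCost.add (steadyCost.add (simplifiedCost.add (deltaCost.add setCost))))).add
    (((id.iter (id.iter (const 1))).add (setCost.add findCost)).add setCost)

theorem igeaCost : IsPoly igeaCost :=
  (id.iter setCost).add (id.iter (steadyCost.add ((id.iter setCost₂).add (xiCost.add
    (setCost.add (id.iter setCost₂))))))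

end IsPoly

/-! ### The universe of atom occurrences and the size of a theory -/

/-- The occurrences of atoms in a theory. -/
def Theory.occurrences {α : Type} (T : Theory α) : List α := T.flatMap fun c => c.head ++ c.body

theorem Theory.length_occurrences_add_length {α : Type} (T : Theory α) :
    T.occurrences.length + List.length T = T.size := by
  induction T with
  | nil => rfl
  | cons c T ih =>
    simp only [Theory.occurrences, Theory.size, List.flatMap_cons, List.length_append,
      List.length_cons, List.map_cons, List.sum_cons] at ih ⊢
    omega

theorem Theory.within_occurrences {α : Type} (T : Theory α) : T.Within T.occurrences T.size := by
  have hlen := T.length_occurrences_add_length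
  refine ⟨by omega, fun c hc => ?_⟩
  have hsub : (c.head ++ c.body).Sublist T.occurrences :=
    List.sublist_flatten_of_mem (List.mem_map.2 ⟨c, hc, rfl⟩)
  have := hsub.length_le
  rw [List.length_append] at this
  exact ⟨by omega, by omega, fun a ha => hsub.subset (by simp [ha]),
    fun a ha => hsub.subset (by simp [ha])⟩

end CNF

theorem mainTheorem2 :
    ∃ p : Polynomial ℕ, ∀ (α : Type) [DecidableEq α] (sel : CNF.Selection α) (T : CNF.Theory α),
      T.Positive →
      ∃ (v : CNF.Verdict) (M : List α),
        CNF.HaltsWithin (CNF.igea (CNF.xiHEF sel) T) (p.eval T.size) (v, M) ∧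
        (T.IsHEF → v = CNF.Verdict.success ∧ T.IsMinimalModel {a | a ∈ M}) ∧
        (¬ T.IsHEF →
          (v = CNF.Verdict.success ∧ T.IsMinimalModel {a | a ∈ M}) ∨
          (v = CNF.Verdict.failure ∧ T.IsModel {a | a ∈ M})) := by
  obtain ⟨p, hp⟩ := CNF.IsPoly.igeaCost
  refine ⟨p, fun α _ sel T hpos => ?_⟩
  have hlen := T.length_occurrences_add_length
  obtain ⟨⟨v, M⟩, hvM, hrun⟩ := (CNF.runs_igea sel (U := T.occurrences) (n := T.size) (by omega)
    T.within_occurrences (fun a ha => by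
      simpa [CNF.Theory.occurrences, CNF.Theory.atoms, CNF.Clause.H, CNF.Clause.B] using ha)
    hpos).haltsWithin
  refine ⟨v, M, hp T.size ▸ hrun, fun hHEF => ?_, fun _ => ?_⟩
  · exact hvM.resolve_right fun h => h.2.2 hHEF
  · exact hvM.imp_right fun h => ⟨h.1, h.2.1⟩
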